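/- Theorem 3.1. Regard $\mathbb{Z}^d$ as a graph in which two vertices are adjacent when they differ by one in exactly one coordinate, and let $\mathrm{dist}$ be its graph distance. A vertex is odd if it is at odd distance from the origin $\mathbf{0}$. A set $S \subset \mathbb{Z}^d$ is odd if every vertex of $S$ that is adjacent to some vertex of $S^c$ is odd, and $S$ is regular if neither $S$ nor $S^c$ has an isolated vertex, i.e. every vertex of $S$ has a neighbor in $S$ and every vertex of $S^c$ has a neighbor in $S^c$. For an integer $r \ge 1$, let $(\mathbb{Z}^d)^{\otimes r}$ be the graph on $\mathbb{Z}^d$ in which two distinct vertices are adjacent if their distance in $\mathbb{Z}^d$ is at most $r$. An $r$-cutset is a (non-empty) finite regular set $S \subset \mathbb{Z}^d$ such that both $S$ and $S^c$ induce connected subgraphs of $(\mathbb{Z}^d)^{\otimes r}$. Let $\partial S$ be the set of edges of $\mathbb{Z}^d$ with exactly one endpoint in $S$, and let $\mathcal{O}_{n,r}^d$ be the collection of odd $r$-cutsets $S$ in $\mathbb{Z}^d$ with $|\partial S| = n$ and $\mathrm{dist}(\mathbf{0},S) := \min_{v \in S} \mathrm{dist}(\mathbf{0},v) \le r$. There exists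 an absolute constant $C > 0$ such that for all integers $d \ge 2$ and $n, r \ge 1$, the collection $\mathcal{O}_{n,r}^d$ is finite and $$|\mathcal{O}_{n,r}^d| \le 2^{\frac{n}{2d}\left(1 + \frac{C r \log^{3/2} d}{\sqrt{d}}\right)}.$$ -/

import Mathlib

namespace OddCutset

/-- The graph power `G^{⊗r}`: same vertices, two distinct vertices being adjacent when their
distance in `G` is at most `r`. -/
def power {V : Type*} (G : SimpleGraph V) (r : ℕ) : SimpleGraph V where
  Adj u v := u ≠ v ∧ G.edist u v ≤ r
  symm := ⟨fun _ _ h => ⟨h.1.symm, SimpleGraph.edist_comm (G := G) ▸ h.2⟩⟩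
  loopless := ⟨fun _ h => h.1 rfl⟩

/-- The induced subgraph of `G` on `U` is connected (in particular, `U` is non-empty). -/
def ConnectedIn {V : Type*} (G : SimpleGraph V) (U : Set V) : Prop :=
  (G.induce U).Connected

/-- The edge-boundary of `U`: the edges with one endpoint in `U` and the other outside. -/
def edgeBoundary {V : Type*} (G : SimpleGraph V) (U : Set V) : Set (Sym2 V) :=
  {e | ∃ u ∈ U, ∃ w ∈ Uᶜ, G.Adj u w ∧ e = s(u, w)}

/-- The internal vertex-boundary of `U`: the vertices of `U` adjacent to some vertex outside. -/
def internalBoundary {V : Type*} (G : SimpleGraph V) (U : Set V) : Set V :=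
  {u | u ∈ U ∧ ∃ w ∈ Uᶜ, G.Adj u w}

/-- The subgraph induced by `U` has no isolated vertices. -/
def NoIsolated {V : Type*} (G : SimpleGraph V) (U : Set V) : Prop :=
  ∀ u ∈ U, ∃ w ∈ U, G.Adj u w

/-- `U` is regular: both `U` and its complement contain no isolated vertices. -/
def Regular {V : Type*} (G : SimpleGraph V) (U : Set V) : Prop :=
  NoIsolated G U ∧ NoIsolated G Uᶜ

/-- The graph distance between two sets of vertices (`⊤` if one of them is empty). -/
noncomputable def setDist {V : Type*} (G : SimpleGraph V) (U W : Set V) : ℕ∞ :=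
  ⨅ u ∈ U, ⨅ w ∈ W, G.edist u w

/-- The integer lattice `ℤ^d` with nearest-neighbour adjacency: `u` and `v` are adjacent when they
differ by one in exactly one coordinate. -/
def lattice (d : ℕ) : SimpleGraph (Fin d → ℤ) where
  Adj u v := ∃ i, |u i - v i| = 1 ∧ ∀ j, j ≠ i → u j = v j
  symm := ⟨fun _ _ ⟨i, hi, h⟩ => ⟨i, by rw [abs_sub_comm]; exact hi, fun j hj => (h j hj).symm⟩⟩
  loopless := ⟨fun _ ⟨i, hi, _⟩ => by simp at hi⟩

/-- A vertex of `ℤ^d` is odd if it is at odd graph-distance from the origin. -/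
def IsOddVertex {d : ℕ} (v : Fin d → ℤ) : Prop :=
  Odd ((lattice d).dist 0 v)

/-- A subset of `ℤ^d` is odd if its internal vertex-boundary consists of odd vertices. -/
def IsOddSet {d : ℕ} (S : Set (Fin d → ℤ)) : Prop :=
  ∀ v ∈ internalBoundary (lattice d) S, IsOddVertex v

/-- An `r`-cutset: a finite regular subset `S` of `ℤ^d` such that `S` and its complement are
connected in `(ℤ^d)^{⊗r}`. -/
structure IsCutset {d : ℕ} (r : ℕ) (S : Set (Fin d → ℤ)) : Prop where
  finite : S.Finite
  regular : Regular (lattice d) S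
  connected : ConnectedIn (power (lattice d) r) S
  coconnected : ConnectedIn (power (lattice d) r) Sᶜ

/-- The collection of odd `r`-cutsets in `ℤ^d` with exactly `n` boundary edges and at distance at
most `r` from the origin. -/
def oddCutsets (d n r : ℕ) : Set (Set (Fin d → ℤ)) :=
  {S | IsCutset r S ∧ IsOddSet S ∧ (edgeBoundary (lattice d) S).ncard = n ∧
    setDist (lattice d) {0} S ≤ r}

end OddCutset

/-! An odd cutset `S` is encoded in two stages: a cheap approximation, and then a choice among at
most `2 ^ (n / (2d + 1 - ⌈√d⌉))` sets compatible with it. The second stage gives the main term `n /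
(2d)`; the first gives the error term.

Oddness says that even vertices of `S` have all their neighbours in `S` (`ClosedOff`). This passes
to `Sᶜ` with the colours exchanged, so each one-sided argument is used twice. For a boundary edge
`uv` the number of boundary edges at `u` plus the number at `v` is at least `2d`
(`two_mul_le_card_outDirs_add`), so one endpoint has at least `d`. Greedy covering and double
counting then give a set `U` of order `z = n √(d log d) / d²` whose neighbourhood `W` meets every
boundary edge (`exists_separating`). Components of `Wᶜ` do not cross the boundary. Those having a
vertex with at least `d` neighbours off `W` are settled by `O(|U|)` representatives
(`exists_representatives`), and only `O(d |U|)` vertices remain undetermined.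

Revealing few further vertices, with threshold `d` and then `⌈√d⌉`, leaves an approximation in which
each undetermined vertex has fewer than `⌈√d⌉` undetermined neighbours (`exists_refinement`). The
default for an undetermined vertex is "even in, odd out". The vertices where `S` deviates from it
form a vertex cover of the undetermined graph, minimal because `S` is regular, and each deviating
vertex has at least `2d + 1 - ⌈√d⌉` boundary edges to determined vertices. Hence the cover has at
most `m = n / (2d + 1 - ⌈√d⌉)` elements, and branching on uncovered edges gives at most `2 ^ m` such
covers (`approximatedSets_finite_and_ncard_le`).

The `O(z)` vertices describing the approximation lie near the boundary, which is connected at scale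
`2r + 4`: a `ZMod 2` cochain argument based on the exactness of closed 1-cochains on the lattice
(`internalBoundary_unsplittable`). A walk with `O(z)` jumps of length at most `2r + 8` therefore
visits them all, and can be written in `exp (O(r z log d))` ways from a given start. A ray argument
leaves at most `n` starting points. Finally `z log d` is twice `n / (2d) · log^{3/2} d / √d`. -/

namespace OddCutset

variable {d : ℕ}

/-! ### Directions, the `ℓ¹` norm and parity on the lattice. -/

/-- The `2d` signed coordinate directions. -/
abbrev Dir (d : ℕ) := Fin d × Bool

/-- The unit vector of a signed direction. -/
def step (δ : Dir d) : Fin d → ℤ := Pi.single δ.1 (if δ.2 then 1 else -1)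

/-- The opposite direction. -/
def opp (δ : Dir d) : Dir d := (δ.1, !δ.2)

lemma step_opp (δ : Dir d) : step (opp δ) = -step δ := by
  rcases δ with ⟨i, b⟩
  cases b <;> simp [step, opp, ← Pi.single_neg]

lemma step_apply_self (δ : Dir d) : step δ δ.1 = if δ.2 then 1 else -1 := by
  simp [step]

lemma step_apply_of_ne {δ : Dir d} {j : Fin d} (h : j ≠ δ.1) : step δ j = 0 := by
  simp [step, h]

lemma step_apply_self_ne_zero (δ : Dir d) : step δ δ.1 ≠ 0 := by
  rw [step_apply_self]; split_ifs <;> decide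

lemma step_injective : Function.Injective (step (d := d)) := by
  intro δ ε h
  have h1 : δ.1 = ε.1 := by
    by_contra hne
    have := congrFun h δ.1
    rw [step_apply_of_ne hne] at this
    exact step_apply_self_ne_zero δ this
  have h2 := congrFun h δ.1
  rw [step_apply_self, h1, step_apply_self] at h2
  rcases δ with ⟨i, b⟩
  rcases ε with ⟨j, c⟩
  cases b <;> cases c <;> simp_all

lemma adj_iff {x y : Fin d → ℤ} : (lattice d).Adj x y ↔ ∃ δ, y = x + step δ := by
  constructor
  · rintro ⟨i, hi, h⟩
    rcases abs_eq (by norm_num : (0 : ℤ) ≤ 1) |>.1 hi with h1 | h1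
    · refine ⟨(i, false), funext fun j => ?_⟩
      by_cases hj : j = i
      · subst hj; simp [step]; omega
      · simp [step, hj, h j hj]
    · refine ⟨(i, true), funext fun j => ?_⟩
      by_cases hj : j = i
      · subst hj; simp [step]; omega
      · simp [step, hj, h j hj]
  · rintro ⟨δ, rfl⟩
    refine ⟨δ.1, ?_, fun j hj => ?_⟩
    · rw [Pi.add_apply, step_apply_self]; split_ifs <;> simp
    · rw [Pi.add_apply, step_apply_of_ne hj, add_zero]

lemma adj_step (x : Fin d → ℤ) (δ : Dir d) : (lattice d).Adj x (x + step δ) :=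
  adj_iff.2 ⟨δ, rfl⟩

lemma card_dir : Fintype.card (Dir d) = 2 * d := by
  simp [Dir, mul_comm]

/-- The `ℓ¹` norm. -/
def l1 (x : Fin d → ℤ) : ℕ := ∑ i, (x i).natAbs

lemma l1_zero : l1 (0 : Fin d → ℤ) = 0 := by simp [l1]

lemma l1_neg (x : Fin d → ℤ) : l1 (-x) = l1 x := by simp [l1]

lemma l1_sub_comm (x y : Fin d → ℤ) : l1 (x - y) = l1 (y - x) := by
  rw [← l1_neg, neg_sub]

lemma l1_add_le (x y : Fin d → ℤ) : l1 (x + y) ≤ l1 x + l1 y := by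
  unfold l1
  rw [← Finset.sum_add_distrib]
  exact Finset.sum_le_sum fun i _ => Int.natAbs_add_le _ _

lemma l1_sub_le (x y z : Fin d → ℤ) : l1 (x - z) ≤ l1 (x - y) + l1 (y - z) := by
  simpa using l1_add_le (x - y) (y - z)

lemma l1_step (δ : Dir d) : l1 (step δ) = 1 := by
  unfold l1
  rw [Finset.sum_eq_single δ.1]
  · rw [step_apply_self]; split_ifs <;> rfl
  · intro j _ hj; rw [step_apply_of_ne hj]; rfl
  · simp

lemma l1_of_adj {x y : Fin d → ℤ} (h : (lattice d).Adj x y) : l1 (x - y) = 1 := by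
  obtain ⟨δ, rfl⟩ := adj_iff.1 h
  simpa [l1_neg] using l1_step δ

lemma l1_eq_zero {x : Fin d → ℤ} : l1 x = 0 ↔ x = 0 := by
  simp [l1, funext_iff]

lemma exists_l1_step {x : Fin d → ℤ} (hx : x ≠ 0) : ∃ δ, l1 (x - step δ) + 1 = l1 x := by
  obtain ⟨i, hi⟩ := Function.ne_iff.1 hx
  have key : ∀ b : Bool, (x i - (if b then 1 else -1)).natAbs + 1 = (x i).natAbs →
      l1 (x - step (i, b)) + 1 = l1 x := by
    intro b hb
    unfold l1
    rw [← Finset.add_sum_erase _ _ (Finset.mem_univ i),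
      ← Finset.add_sum_erase _ (fun j => (x j).natAbs) (Finset.mem_univ i), ← hb]
    have h1 : ∑ j ∈ Finset.univ.erase i, ((x - step (i, b)) j).natAbs =
        ∑ j ∈ Finset.univ.erase i, (x j).natAbs := by
      refine Finset.sum_congr rfl fun j hj => ?_
      rw [Pi.sub_apply, step_apply_of_ne (Finset.ne_of_mem_erase hj), sub_zero]
    rw [h1, Pi.sub_apply, step_apply_self (i, b)]
    ring
  simp only [Pi.zero_apply] at hi
  rcases lt_or_gt_of_ne hi with h | h
  · exact ⟨(i, false), key false (by simp; omega)⟩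
  · exact ⟨(i, true), key true (by simp; omega)⟩

/-- The displacement of a possibly idle step. -/
def idleStep : Option (Dir d) → (Fin d → ℤ)
  | none => 0
  | some δ => step δ

lemma exists_sum_idleStep {R : ℕ} {x : Fin d → ℤ} (hx : l1 x ≤ R) :
    ∃ g : Fin R → Option (Dir d), x = ∑ i, idleStep (g i) := by
  induction R generalizing x with
  | zero => exact ⟨fun _ => none, by simpa [l1_eq_zero] using hx⟩
  | succ R ih =>
    by_cases h0 : x = 0
    · exact ⟨fun _ => none, by simp [h0, idleStep]⟩
    · obtain ⟨δ, hδ⟩ := exists_l1_step h0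
      obtain ⟨g, hg⟩ := ih (x := x - step δ) (by omega)
      refine ⟨Fin.cons (some δ) g, ?_⟩
      rw [Fin.sum_univ_succ]
      simp only [Fin.cons_zero, Fin.cons_succ]
      rw [← hg]
      simp [idleStep]

lemma l1_le_walk_length {x y : Fin d → ℤ} (p : (lattice d).Walk x y) : l1 (x - y) ≤ p.length := by
  induction p with
  | nil => simp [l1_zero]
  | cons h p ih =>
    have := l1_sub_le _ _ _ |>.trans (add_le_add (l1_of_adj h).le ih)
    simpa [add_comm] using this

lemma reachable_zero (x : Fin d → ℤ) : (lattice d).Reachable 0 x := by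
  induction h : l1 x generalizing x with
  | zero => rw [l1_eq_zero.1 h]
  | succ k ih =>
    have hx : x ≠ 0 := by rintro rfl; simp [l1_zero] at h
    obtain ⟨δ, hδ⟩ := exists_l1_step hx
    refine (ih (x - step δ) (by omega)).trans (SimpleGraph.Adj.reachable ?_)
    simpa using adj_step (x - step δ) δ

/-- The parity of the sum of the coordinates. -/
def parity (x : Fin d → ℤ) : ZMod 2 := ∑ i, (x i : ZMod 2)

lemma parity_step (δ : Dir d) : parity (step δ) = 1 := by
  unfold parity
  rw [Finset.sum_eq_single δ.1]
  · rw [step_apply_self]; split_ifs <;> simp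
  · intro j _ hj; rw [step_apply_of_ne hj]; rfl
  · simp

lemma parity_add (x y : Fin d → ℤ) : parity (x + y) = parity x + parity y := by
  simp [parity, Finset.sum_add_distrib]

lemma parity_walk {x y : Fin d → ℤ} (p : (lattice d).Walk x y) :
    parity y = parity x + p.length := by
  induction p with
  | nil => simp
  | cons h p ih =>
    obtain ⟨δ, rfl⟩ := adj_iff.1 h
    rw [ih, parity_add, parity_step]
    push_cast [SimpleGraph.Walk.length_cons]
    ring

lemma isOddVertex_iff (x : Fin d → ℤ) : IsOddVertex x ↔ parity x = 1 := by
  obtain ⟨p, hp⟩ := (reachable_zero x).exists_walk_length_eq_dist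
  rw [IsOddVertex, ← hp, parity_walk p, ← ZMod.natCast_eq_one_iff_odd]
  simp [parity]

/-! ### Colour classes and sets closed off a class. -/

/-- `o` is one of the two colour classes of a proper two-colouring of the lattice. -/
def IsClass (o : Set (Fin d → ℤ)) : Prop :=
  ∀ ⦃x y⦄, (lattice d).Adj x y → (x ∈ o ↔ y ∉ o)

lemma isClass_odd : IsClass {x : Fin d → ℤ | IsOddVertex x} := by
  intro x y h
  obtain ⟨δ, rfl⟩ := adj_iff.1 h
  simp only [Set.mem_ofPred_eq, isOddVertex_iff, parity_add, parity_step]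
  generalize parity x = a
  revert a
  decide

lemma IsClass.compl {o : Set (Fin d → ℤ)} (h : IsClass o) : IsClass oᶜ := by
  intro x y hxy
  have := h hxy
  simp only [Set.mem_compl_iff]
  tauto

/-- Outside the class `o`, vertices of `S` have all of their neighbours in `S`. -/
def ClosedOff (o S : Set (Fin d → ℤ)) : Prop :=
  ∀ ⦃x⦄, x ∈ S → x ∉ o → ∀ ⦃y⦄, (lattice d).Adj x y → y ∈ S

/-- The symmetry between `S` and its complement. It is the reason for working with an arbitrary
class `o` instead of the odd vertices. -/
lemma ClosedOff.compl {o S : Set (Fin d → ℤ)} (ho : IsClass o) (h : ClosedOff o S) :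
    ClosedOff oᶜ Sᶜ := by
  intro x hx hxo y hxy hy
  exact hx (h hy ((ho hxy).1 (not_not.1 hxo)) hxy.symm)

lemma IsOddSet.closedOff {S : Set (Fin d → ℤ)} (h : IsOddSet S) :
    ClosedOff {x : Fin d → ℤ | IsOddVertex x} S := by
  intro x hx hxo y hxy
  by_contra hy
  exact hxo (h x ⟨hx, y, hy, hxy⟩)

lemma Regular.compl {S : Set (Fin d → ℤ)} (h : Regular (lattice d) S) :
    Regular (lattice d) Sᶜ := by
  refine ⟨h.2, ?_⟩
  rw [compl_compl]
  exact h.1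

/-! ### Exactness of closed cochains and connectivity of the boundary. -/

lemma exists_antidifference {A : Type*} [AddCommGroup A] (b : ℤ → A) :
    ∃ φ : ℤ → A, ∀ z, φ (z + 1) = φ z + b z := by
  refine ⟨fun z => ∑ j ∈ Finset.range z.toNat, b j -
    ∑ j ∈ Finset.range (-z).toNat, b (-(j : ℤ) - 1), fun z => ?_⟩
  rcases le_or_gt 0 z with hz | hz
  · lift z to ℕ using hz
    have h1 : ((z : ℤ) + 1).toNat = z + 1 := by omega
    have h2 : (-((z : ℤ) + 1)).toNat = 0 := by omega
    have h3 : (-(z : ℤ)).toNat = 0 := by omega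
    simp only [h1, h2, h3, Finset.sum_range_succ, Finset.range_zero, Finset.sum_empty,
      Int.toNat_natCast]
    abel
  · obtain ⟨k, rfl⟩ : ∃ k : ℕ, z = -(k : ℤ) - 1 := ⟨(-z - 1).toNat, by omega⟩
    have h1 : (-(k : ℤ) - 1 + 1).toNat = 0 := by omega
    have h2 : (-(-(k : ℤ) - 1 + 1)).toNat = k := by omega
    have h3 : (-(-(k : ℤ) - 1)).toNat = k + 1 := by omega
    have h4 : (-(k : ℤ) - 1).toNat = 0 := by omega
    simp only [h1, h2, h3, h4, Finset.sum_range_succ, Finset.range_zero, Finset.sum_empty]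
    abel

/-- A closed `1`-cochain on the lattice is exact. -/
lemma exists_potential {A : Type*} [AddCommGroup A] (a : (Fin d → ℤ) → Fin d → A)
    (ha : ∀ x i j, a x i + a (x + step (i, true)) j = a x j + a (x + step (j, true)) i) :
    ∃ g : (Fin d → ℤ) → A, ∀ x i, g (x + step (i, true)) = g x + a x i := by
  suffices H : ∀ k ≤ d, ∃ g : (Fin d → ℤ) → A, ∀ x (i : Fin d), i.val < k →
      g (x + step (i, true)) = g x + a x i by
    obtain ⟨g, hg⟩ := H d le_rfl
    exact ⟨g, fun x i => hg x i i.2⟩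
  intro k
  induction k with
  | zero => exact fun _ => ⟨fun _ => 0, fun _ _ h => absurd h (Nat.not_lt_zero _)⟩
  | succ k ih =>
    intro hk
    obtain ⟨g, hg⟩ := ih (by omega)
    -- The induction integrates one coordinate at a time. Choosing `Φ` as a function of the sequence
    -- to be summed makes the correction depend only on the values of `a'` along a line.
    choose Φ hΦ using exists_antidifference (A := A)
    let i₀ : Fin d := ⟨k, hk⟩
    let a' : (Fin d → ℤ) → A := fun x => a x i₀ - (g (x + step (i₀, true)) - g x)
    -- Closedness makes the remaining error in direction `i₀` invariant under the directions already
    -- integrated, so correcting it does not spoil them.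
    have ha' : ∀ x (i : Fin d), i.val < k → a' (x + step (i, true)) = a' x := by
      intro x i hi
      have h1 := ha x i i₀
      have h2 := hg x i hi
      have h3 := hg (x + step (i₀, true)) i hi
      have h4 : x + step (i, true) + step (i₀, true) = x + step (i₀, true) + step (i, true) := by
        abel
      have h5 : a (x + step (i, true)) i₀ = a x i₀ + a (x + step (i₀, true)) i - a x i := by
        rw [← h1]; abel
      simp only [a', h4, h2, h3, h5]
      abel
    refine ⟨fun x => g x + Φ (fun z => a' (Function.update x i₀ z)) (x i₀), fun x i hi => ?_⟩
    rcases Nat.lt_succ_iff_lt_or_eq.1 hi with hi | hi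
    · have hne : i₀ ≠ i := by rintro rfl; simp [i₀] at hi
      have h1 : (fun z => a' (Function.update (x + step (i, true)) i₀ z)) =
          fun z => a' (Function.update x i₀ z) := by
        funext z
        rw [← ha' (Function.update x i₀ z) i hi]
        congr 1
        funext j
        by_cases hj : j = i₀
        · subst hj
          simp [step_apply_of_ne (δ := (i, true)) hne]
        · simp [hj]
      simp only [h1, hg x i hi, Pi.add_apply, step_apply_of_ne (δ := (i, true)) hne, add_zero]
      abel
    · obtain rfl : i = i₀ := Fin.ext hi
      have h1 : ∀ z, Function.update (x + step (i₀, true)) i₀ z = Function.update x i₀ z := by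
        intro z
        funext j
        by_cases hj : j = i₀
        · subst hj; simp
        · simp [hj, step_apply_of_ne (δ := (i₀, true)) hj]
      have h2 : step (i₀, true) i₀ = 1 := by simp [step]
      simp only [h1, Pi.add_apply, h2, hΦ, Function.update_eq_self]
      simp only [a']
      abel

section boundary

variable (S : Set (Fin d → ℤ)) (P : (Fin d → ℤ) → Prop)

open Classical in
/-- The indicator, with values in `ZMod 2`, of the boundary edges whose inner endpoint satisfies
`P`. -/
noncomputable def boundaryCochain (x y : Fin d → ℤ) : ZMod 2 :=
  if (x ∈ S ∧ y ∉ S ∧ P x) ∨ (y ∈ S ∧ x ∉ S ∧ P y) then 1 else 0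

open Classical in
/-- The indicator of `S` with values in `ZMod 2`. -/
noncomputable def ind₂ (x : Fin d → ℤ) : ZMod 2 := if x ∈ S then 1 else 0

variable {S P}

lemma boundaryCochain_comm (x y : Fin d → ℤ) :
    boundaryCochain S P x y = boundaryCochain S P y x := by
  unfold boundaryCochain
  congr 1
  exact propext or_comm

/-- Within `Z` either all boundary vertices satisfy `P` or none does, and `c` records which. The
cochain is thus locally a multiple of the coboundary of the indicator of `S`. -/
lemma exists_boundaryCochain_eq {Z : Set (Fin d → ℤ)}
    (hZ : ∀ u ∈ Z, ∀ u' ∈ Z, u ∈ internalBoundary (lattice d) S →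
      u' ∈ internalBoundary (lattice d) S → (P u ↔ P u')) :
    ∃ c : ZMod 2, ∀ x ∈ Z, ∀ y ∈ Z, (lattice d).Adj x y →
      boundaryCochain S P x y = c * (ind₂ S x + ind₂ S y) := by
  classical
  refine ⟨if ∃ u ∈ Z, u ∈ internalBoundary (lattice d) S ∧ P u then 1 else 0,
    fun x hx y hy hxy => ?_⟩
  have key : ∀ x ∈ Z, x ∈ S → ∀ y, y ∉ S → (lattice d).Adj x y →
      ((∃ u ∈ Z, u ∈ internalBoundary (lattice d) S ∧ P u) ↔ P x) := by
    intro x hx hxS y hyS hxy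
    have hxb : x ∈ internalBoundary (lattice d) S := ⟨hxS, y, hyS, hxy⟩
    exact ⟨fun ⟨u, hu, hub, hP⟩ => (hZ u hu x hx hub hxb).1 hP, fun h => ⟨x, hx, hxb, h⟩⟩
  by_cases h1 : x ∈ S <;> by_cases h2 : y ∈ S
  · simp only [boundaryCochain, ind₂, h1, h2]
    have : (1 : ZMod 2) + 1 = 0 := by decide
    simp [this]
  · simp only [boundaryCochain, ind₂, h1, h2, key x hx h1 y h2 hxy]
    simp
  · simp only [boundaryCochain, ind₂, h1, h2, key y hy h2 x h1 hxy.symm]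
    simp
  · simp [boundaryCochain, ind₂, h1, h2]

lemma connectedIn_const {V : Type*} {G : SimpleGraph V} {U : Set V} (h : ConnectedIn G U)
    {β : Type*} {g : V → β} (hg : ∀ x ∈ U, ∀ y ∈ U, G.Adj x y → g x = g y) {x y : V}
    (hx : x ∈ U) (hy : y ∈ U) : g x = g y := by
  obtain ⟨p⟩ := h.preconnected ⟨x, hx⟩ ⟨y, hy⟩
  have key : ∀ (a b : U) (_ : (G.induce U).Walk a b), g a = g b := by
    intro a b p
    induction p with
    | nil => rfl
    | cons h _ ih => exact (hg _ (Subtype.prop _) _ (Subtype.prop _) h).trans ih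
  exact key _ _ p

/-- The internal boundary of an `r`-cutset cannot be split into two distant parts. -/
lemma internalBoundary_unsplittable {r : ℕ} (hS : ConnectedIn (power (lattice d) r) S)
    (hS' : ConnectedIn (power (lattice d) r) Sᶜ)
    (hP : ∀ u ∈ internalBoundary (lattice d) S, ∀ u' ∈ internalBoundary (lattice d) S,
      l1 (u - u') ≤ 2 * r + 4 → (P u ↔ P u')) :
    (∀ u ∈ internalBoundary (lattice d) S, P u) ∨
      ∀ u ∈ internalBoundary (lattice d) S, ¬ P u := by
  -- Two points of a ball of radius `r + 2` are within `2 * r + 4`. The radius accommodates both a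
  -- unit square at `x` (for closedness) and a path of length `r` from `x`.
  have cluster : ∀ x : Fin d → ℤ, ∃ c : ZMod 2, ∀ y z, l1 (x - y) ≤ r + 2 → l1 (x - z) ≤ r + 2 →
      (lattice d).Adj y z → boundaryCochain S P y z = c * (ind₂ S y + ind₂ S z) := by
    intro x
    obtain ⟨c, hc⟩ := exists_boundaryCochain_eq (S := S) (P := P) (Z := {y | l1 (x - y) ≤ r + 2})
      (by
        intro u hu u' hu' hub hub'
        refine hP u hub u' hub' ?_
        have := l1_sub_le u x u'
        rw [l1_sub_comm u x] at this
        have h1 : l1 (x - u) ≤ r + 2 := hu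
        have h2 : l1 (x - u') ≤ r + 2 := hu'
        omega)
    exact ⟨c, fun y z hy hz h => hc y hy z hz h⟩
  obtain ⟨g, hg⟩ := exists_potential
    (fun (x : Fin d → ℤ) (i : Fin d) => boundaryCochain S P x (x + step (i, true))) (by
      intro x i j
      obtain ⟨c, hc⟩ := cluster x
      have b0 : l1 (x - x) ≤ r + 2 := by simp [l1_zero]
      have b1 : ∀ i, l1 (x - (x + step (i, true))) ≤ r + 2 := by
        intro i
        rw [l1_of_adj (adj_step _ _)]; omega
      have b2 : ∀ i j, l1 (x - (x + step (i, true) + step (j, true))) ≤ r + 2 := by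
        intro i j
        have := l1_sub_le x (x + step (i, true)) (x + step (i, true) + step (j, true))
        rw [l1_of_adj (adj_step _ _), l1_of_adj (adj_step _ _)] at this
        omega
      have hcomm : x + step (i, true) + step (j, true) = x + step (j, true) + step (i, true) := by
        abel
      rw [hc _ _ b0 (b1 i) (adj_step _ _), hc _ _ b0 (b1 j) (adj_step _ _),
        hc _ _ (b1 i) (b2 i j) (adj_step _ _), hc _ _ (b1 j) (b2 j i) (adj_step _ _), hcomm]
      generalize ind₂ S x = p
      generalize ind₂ S (x + step (i, true)) = q
      generalize ind₂ S (x + step (j, true)) = s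
      generalize ind₂ S (x + step (j, true) + step (i, true)) = t
      have : ∀ c p q s t : ZMod 2, c * (p + q) + c * (q + t) = c * (p + s) + c * (s + t) := by
        decide
      exact this _ _ _ _ _)
  have hadj : ∀ x y, (lattice d).Adj x y → g x + g y = boundaryCochain S P x y := by
    have dbl : ∀ p q : ZMod 2, p + (p + q) = q := by decide
    have dbl' : ∀ p q : ZMod 2, p + q + p = q := by decide
    intro x y hxy
    obtain ⟨⟨i, b⟩, rfl⟩ := adj_iff.1 hxy
    cases b
    · have h := hg (x + step (i, false)) i
      have h1 : x + step (i, false) + step (i, true) = x := by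
        have := step_opp (d := d) (i, false)
        simp only [opp, Bool.not_false] at this
        rw [this]; abel
      simp only [h1] at h
      rw [h, boundaryCochain_comm, dbl']
    · rw [hg, dbl]
  -- A lattice path realising a jump stays in one ball, where the increments of `g` telescope to `c`
  -- times the change of the indicator. This vanishes if the endpoints are on the same side, so `g`
  -- is constant on `S` and on `Sᶜ`.
  have hconst : ∀ x y, (x ∈ S ↔ y ∈ S) → (power (lattice d) r).Adj x y → g x = g y := by
    intro x y hS hxy
    obtain ⟨p, hp⟩ := SimpleGraph.exists_walk_of_edist_ne_top
      (ne_top_of_le_ne_top (ENat.natCast_ne_top r) hxy.2)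
    have hpr : p.length ≤ r := by
      have := hxy.2
      rw [← hp] at this
      exact_mod_cast this
    obtain ⟨c, hc⟩ := cluster x
    have key : ∀ (u v : Fin d → ℤ) (q : (lattice d).Walk u v), l1 (x - u) + q.length ≤ r →
        g u + g v = c * (ind₂ S u + ind₂ S v) := by
      intro u v q
      induction q with
      | nil =>
        intro _
        have : ∀ p q c : ZMod 2, p + p = c * (q + q) := by decide
        exact this _ _ _
      | @cons u w v h q ih =>
        intro hl
        rw [SimpleGraph.Walk.length_cons] at hl
        have h1 := l1_sub_le x u w
        rw [l1_of_adj h] at h1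
        have h2 := ih (by omega)
        have h3 := hadj u w h
        rw [hc u w (by omega) (by omega) h] at h3
        have : ∀ a b e c p q s : ZMod 2, a + b = c * (p + q) → b + e = c * (q + s) →
            a + e = c * (p + s) := by decide
        exact this _ _ _ _ _ _ _ h3 h2
    have h1 := key x y p (by simpa [l1_zero] using hpr)
    have h2 : ind₂ S x = ind₂ S y := by
      unfold ind₂
      by_cases h : x ∈ S
      · rw [if_pos h, if_pos (hS.1 h)]
      · rw [if_neg h, if_neg (mt hS.2 h)]
    rw [h2] at h1
    have : ∀ a b c p : ZMod 2, a + b = c * (p + p) → a = b := by decide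
    exact this _ _ _ _ h1
  -- The jump of `g` across a boundary edge is therefore the same for all of them, and this jump is
  -- the truth value of `P`.
  have hval : ∀ u ∈ internalBoundary (lattice d) S, ∀ u' ∈ internalBoundary (lattice d) S,
      P u → P u' := by
    rintro u ⟨hu, w, hw, huw⟩ u' ⟨hu', w', hw', huw'⟩ hPu
    have h1 : g u = g u' := connectedIn_const hS
      (fun x hx y hy h => hconst x y (by simp [hx, hy]) h) hu hu'
    have h2 : g w = g w' := connectedIn_const hS'
      (fun x hx y hy h => hconst x y (iff_of_false hx hy) h) hw hw'
    have h3 := hadj u w huw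
    have h4 := hadj u' w' huw'
    rw [h1, h2, h4] at h3
    have hw0 : w ∉ S := hw
    have hw0' : w' ∉ S := hw'
    by_contra hPu'
    simp [boundaryCochain, hu, hu', hw0, hw0', hPu, hPu'] at h3
  by_cases h : ∃ u ∈ internalBoundary (lattice d) S, P u
  · obtain ⟨u, hu, hPu⟩ := h
    exact Or.inl fun u' hu' => hval u hu u' hu' hPu
  · push Not at h
    exact Or.inr h

end boundary

/-! ### Boundary edges and isoperimetry. -/

/-- The boundary edges of `S`, oriented outwards. -/
def edgePairs (S : Set (Fin d → ℤ)) : Set ((Fin d → ℤ) × (Fin d → ℤ)) :=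
  {p | p.1 ∈ S ∧ p.2 ∉ S ∧ (lattice d).Adj p.1 p.2}

lemma edgePairs_finite {S : Set (Fin d → ℤ)} (hS : S.Finite) : (edgePairs S).Finite := by
  refine ((hS.prod (Set.finite_univ (α := Dir d))).image
    fun p => (p.1, p.1 + step p.2)).subset ?_
  rintro ⟨x, y⟩ ⟨hx, -, hxy⟩
  obtain ⟨δ, hδ⟩ := adj_iff.1 hxy
  exact ⟨(x, δ), ⟨hx, Set.mem_univ _⟩, by simp at hδ; simp [hδ]⟩

lemma ncard_edgeBoundary (S : Set (Fin d → ℤ)) :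
    (edgeBoundary (lattice d) S).ncard = (edgePairs S).ncard := by
  have h : edgeBoundary (lattice d) S = (fun p => s(p.1, p.2)) '' edgePairs S := by
    ext e
    constructor
    · rintro ⟨u, hu, w, hw, huw, rfl⟩
      exact ⟨(u, w), ⟨hu, hw, huw⟩, rfl⟩
    · rintro ⟨⟨u, w⟩, ⟨hu, hw, huw⟩, rfl⟩
      exact ⟨u, hu, w, hw, huw, rfl⟩
  rw [h, Set.InjOn.ncard_image]
  rintro ⟨u, w⟩ ⟨hu, hw, -⟩ ⟨u', w'⟩ ⟨hu', hw', -⟩ he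
  simp only [Sym2.eq_iff] at he
  rcases he with ⟨rfl, rfl⟩ | ⟨rfl, rfl⟩
  · rfl
  · exact absurd hu hw'

lemma edgePairs_compl (S : Set (Fin d → ℤ)) : edgePairs Sᶜ = Prod.swap '' edgePairs S := by
  ext ⟨x, y⟩
  constructor
  · rintro ⟨hx, hy, hxy⟩
    exact ⟨(y, x), ⟨not_not.1 hy, hx, hxy.symm⟩, rfl⟩
  · rintro ⟨⟨u, w⟩, ⟨hu, hw, huw⟩, he⟩
    obtain ⟨rfl, rfl⟩ := Prod.mk.injEq .. ▸ he
    exact ⟨hw, not_not.2 hu, huw.symm⟩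

lemma ncard_edgePairs_compl (S : Set (Fin d → ℤ)) :
    (edgePairs Sᶜ).ncard = (edgePairs S).ncard := by
  rw [edgePairs_compl, Set.ncard_image_of_injective _ Prod.swap_injective]

open Classical in
/-- The directions that lead from `x` out of `S`. -/
noncomputable def outDirs (S : Set (Fin d → ℤ)) (x : Fin d → ℤ) : Finset (Dir d) :=
  Finset.univ.filter fun δ => x + step δ ∉ S

lemma mem_outDirs {S : Set (Fin d → ℤ)} {x : Fin d → ℤ} {δ : Dir d} :
    δ ∈ outDirs S x ↔ x + step δ ∉ S := by
  simp [outDirs]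

lemma card_outDirs_add (S : Set (Fin d → ℤ)) (x : Fin d → ℤ) :
    (outDirs S x).card + (outDirs Sᶜ x).card = 2 * d := by
  classical
  rw [← card_dir, ← Finset.card_univ, ← Finset.card_filter_add_card_filter_not
    (s := Finset.univ) (fun δ => x + step δ ∉ S)]
  simp [outDirs]

lemma card_mul_le_ncard_edgePairs {S : Set (Fin d → ℤ)} (hS : (edgePairs S).Finite)
    {A : Finset (Fin d → ℤ)} (hA : ∀ a ∈ A, a ∈ S) {k : ℕ}
    (hk : ∀ a ∈ A, k ≤ (outDirs S a).card) : A.card * k ≤ (edgePairs S).ncard := by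
  classical
  have h1 : A.card * k ≤ (A.sigma fun a => outDirs S a).card := by
    rw [Finset.card_sigma, ← smul_eq_mul]
    exact Finset.card_nsmul_le_sum _ _ _ hk
  refine h1.trans ?_
  rw [Set.ncard_eq_toFinset_card _ hS]
  refine Finset.card_le_card_of_injOn (fun p => (p.1, p.1 + step p.2)) ?_ ?_
  · rintro ⟨a, δ⟩ h
    have h := Finset.mem_sigma.1 h
    simp only [Set.Finite.coe_toFinset]
    exact ⟨hA _ h.1, mem_outDirs.1 h.2, adj_step _ _⟩
  · rintro ⟨a, δ⟩ - ⟨b, ε⟩ - h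
    obtain ⟨rfl, h2⟩ := Prod.mk.injEq .. ▸ h
    obtain rfl := step_injective (add_left_cancel h2)
    rfl

/-- Here `u` is in `o`. For each direction `δ`, either `u + step δ` is outside `S`, or it is in `S`
off the class `o`, so that its neighbour `v + step δ` is in `S`. Every direction is counted at least
once. -/
lemma two_mul_le_card_outDirs_add {o S : Set (Fin d → ℤ)} (ho : IsClass o) (hc : ClosedOff o S)
    {u v : Fin d → ℤ} (hu : u ∈ S) (hv : v ∉ S) (h : (lattice d).Adj u v) :
    2 * d ≤ (outDirs S u).card + (outDirs Sᶜ v).card := by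
  classical
  rw [← card_dir, ← Finset.card_univ]
  refine le_trans (Finset.card_le_card fun δ _ => ?_) (Finset.card_union_le _ _)
  rw [Finset.mem_union, mem_outDirs, mem_outDirs]
  by_contra! hcon
  obtain ⟨ε, rfl⟩ := adj_iff.1 h
  have huo : u ∈ o := by
    by_contra huo
    exact hv (hc hu huo h)
  have h1 : (lattice d).Adj (u + step δ) (u + step ε + step δ) := by
    have := adj_step (u + step δ) ε
    rwa [add_right_comm] at this
  have h2 := hc hcon.1 ((ho (adj_step u δ)).1 huo) h1
  exact hcon.2 h2

lemma exists_exit {B : Set (Fin d → ℤ)} (hB : B.Finite) {x : Fin d → ℤ} (hx : x ∈ B) (δ : Dir d) :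
    ∃ k : ℕ, (∀ j ≤ k, x + (j : ℤ) • step δ ∈ B) ∧ x + ((k + 1 : ℕ) : ℤ) • step δ ∉ B := by
  classical
  have hex : ∃ k : ℕ, x + (k : ℤ) • step δ ∉ B := by
    by_contra! hall
    refine Set.infinite_of_injective_forall_mem (f := fun k : ℕ => x + (k : ℤ) • step δ) ?_ hall hB
    intro a b hab
    have := congrFun (add_left_cancel hab) δ.1
    simp only [Pi.smul_apply, smul_eq_mul] at this
    exact_mod_cast mul_right_cancel₀ (step_apply_self_ne_zero δ) this
  obtain ⟨k, hk⟩ : ∃ k, Nat.find hex = k + 1 := by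
    refine Nat.exists_eq_succ_of_ne_zero fun h0 => ?_
    have := Nat.find_spec hex
    rw [h0] at this
    simp [hx] at this
  refine ⟨k, fun j hj => ?_, hk ▸ Nat.find_spec hex⟩
  exact not_not.1 (Nat.find_min hex (m := j) (by omega))

/-- The nonzero coordinates and their signs determine the unordered pair of directions; a swap
remains possible since the multiple may be one. -/
lemma step_add_smul_eq {e f e' f' : Dir d} {k k' : ℕ} (h : f.1 ≠ e.1) (h' : f'.1 ≠ e'.1)
    (heq : step e + ((k + 1 : ℕ) : ℤ) • step f = step e' + ((k' + 1 : ℕ) : ℤ) • step f') :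
    (e' = e ∧ f' = f) ∨ (e' = f ∧ f' = e) := by
  have hj : ∀ j, step e j + (k + 1 : ℤ) * step f j = step e' j + (k' + 1 : ℤ) * step f' j := by
    intro j
    have := congrFun heq j
    simpa using this
  have hsgn : ∀ b : Bool, (if b then (1 : ℤ) else -1) = 1 ∧ b = true ∨
      (if b then (1 : ℤ) else -1) = -1 ∧ b = false := by decide
  have h1 := hj e.1
  have h2 := hj f.1
  rw [step_apply_self, step_apply_of_ne h.symm] at h1
  rw [step_apply_self, step_apply_of_ne h] at h2
  obtain ⟨ei, eb⟩ := e
  obtain ⟨fi, fb⟩ := f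
  obtain ⟨ei', eb'⟩ := e'
  obtain ⟨fi', fb'⟩ := f'
  simp only at h h' h1 h2
  by_cases a1 : ei = ei'
  · subst a1
    have a2 : fi = fi' := by
      by_contra a2
      rw [step_apply_of_ne (δ := (ei, eb')) h, step_apply_of_ne (δ := (fi', fb')) a2] at h2
      rcases hsgn fb with ⟨hs, -⟩ | ⟨hs, -⟩ <;> rw [hs] at h2 <;> omega
    subst a2
    rw [step_apply_self (ei, eb'), step_apply_of_ne (δ := (fi, fb')) h'.symm] at h1
    rw [step_apply_self (fi, fb'), step_apply_of_ne (δ := (ei, eb')) h] at h2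
    left
    rcases hsgn fb with ⟨hs, rfl⟩ | ⟨hs, rfl⟩ <;> rcases hsgn eb with ⟨hs2, rfl⟩ | ⟨hs2, rfl⟩ <;>
    rcases hsgn fb' with ⟨hs3, rfl⟩ | ⟨hs3, rfl⟩ <;>
    rcases hsgn eb' with ⟨hs4, rfl⟩ | ⟨hs4, rfl⟩ <;> simp at h1 h2 ⊢ <;> omega
  · have a2 : ei = fi' := by
      by_contra a2
      rw [step_apply_of_ne (δ := (ei', eb')) a1, step_apply_of_ne (δ := (fi', fb')) a2] at h1
      rcases hsgn eb with ⟨hs, -⟩ | ⟨hs, -⟩ <;> rw [hs] at h1 <;> omega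
    subst a2
    have a3 : fi = ei' := by
      by_contra a3
      rw [step_apply_of_ne (δ := (ei', eb')) a3, step_apply_of_ne (δ := (ei, fb')) h] at h2
      rcases hsgn fb with ⟨hs, -⟩ | ⟨hs, -⟩ <;> rw [hs] at h2 <;> omega
    subst a3
    rw [step_apply_self (ei, fb'), step_apply_of_ne (δ := (fi, eb')) h'] at h1
    rw [step_apply_self (fi, eb'), step_apply_of_ne (δ := (ei, fb')) h] at h2
    right
    rcases hsgn fb with ⟨hs, rfl⟩ | ⟨hs, rfl⟩ <;> rcases hsgn eb with ⟨hs2, rfl⟩ | ⟨hs2, rfl⟩ <;>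
    rcases hsgn fb' with ⟨hs3, rfl⟩ | ⟨hs3, rfl⟩ <;>
    rcases hsgn eb' with ⟨hs4, rfl⟩ | ⟨hs4, rfl⟩ <;> simp at h1 h2 ⊢ <;> omega

/-- A finite set containing many neighbours of a vertex has a large outer vertex-boundary. -/
lemma exists_large_outer_boundary {B : Set (Fin d → ℤ)} (hB : B.Finite) {x : Fin d → ℤ}
    {E : Finset (Dir d)} (hE : ∀ e ∈ E, x + step e ∈ B) :
    ∃ W : Finset (Fin d → ℤ), (∀ w ∈ W, w ∉ B ∧ ∃ y ∈ B, (lattice d).Adj y w) ∧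
      E.card * (d - 1) ≤ W.card := by
  classical
  have hex : ∀ p : Dir d × Dir d, ∃ k : ℕ, p.1 ∈ E →
      (∀ j ≤ k, x + step p.1 + (j : ℤ) • step p.2 ∈ B) ∧
        x + step p.1 + ((k + 1 : ℕ) : ℤ) • step p.2 ∉ B := by
    intro p
    by_cases hp : p.1 ∈ E
    · obtain ⟨k, hk⟩ := exists_exit hB (hE _ hp) p.2
      exact ⟨k, fun _ => hk⟩
    · exact ⟨0, fun h => absurd h hp⟩
  choose k hk using hex
  -- From each `x + step e` a ray is shot in each of the `2 * (d - 1)` directions transversal to `e`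
  -- until it leaves `B`. An exit point arises from at most two pairs, which costs the factor two.
  let Q : Finset (Dir d × Dir d) := (E ×ˢ Finset.univ).filter fun p => p.2.1 ≠ p.1.1
  let F : Dir d × Dir d → (Fin d → ℤ) := fun p =>
    x + step p.1 + ((k p + 1 : ℕ) : ℤ) • step p.2
  have hQ : ∀ p ∈ Q, p.1 ∈ E ∧ p.2.1 ≠ p.1.1 := by
    intro p hp
    simpa [Q] using hp
  have hQcard : Q.card = E.card * (2 * (d - 1)) := by
    have h1 : Q = Finset.map (α := Σ _ : Dir d, Dir d) (β := Dir d × Dir d) ⟨fun p => (p.1, p.2), by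
          rintro ⟨a, b⟩ ⟨c, e⟩ h
          obtain ⟨rfl, rfl⟩ := Prod.mk.injEq .. ▸ h
          rfl⟩ (E.sigma fun e => Finset.univ.filter fun f : Dir d => f.1 ≠ e.1) := by
      ext ⟨e, f⟩
      simp only [Q, Finset.mem_filter, Finset.mem_product, Finset.mem_map, Finset.mem_sigma,
        Finset.mem_univ, true_and, and_true]
      constructor
      · exact fun h => ⟨⟨e, f⟩, h, rfl⟩
      · rintro ⟨⟨a, b⟩, h, he⟩
        obtain ⟨rfl, rfl⟩ := Prod.mk.injEq .. ▸ he
        exact h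
    rw [h1, Finset.card_map, Finset.card_sigma, Finset.sum_const_nat]
    intro e _
    have h2 : (Finset.univ.filter fun f : Dir d => f.1 ≠ e.1) =
        (Finset.univ.erase e.1) ×ˢ (Finset.univ : Finset Bool) := by
      ext ⟨i, b⟩
      simp
    rw [h2, Finset.card_product, Finset.card_erase_of_mem (Finset.mem_univ _)]
    simp [mul_comm]
  refine ⟨Q.image F, ?_, ?_⟩
  · intro w hw
    obtain ⟨p, hp, rfl⟩ := Finset.mem_image.1 hw
    have h1 := hk p (hQ p hp).1
    refine ⟨h1.2, _, h1.1 (k p) le_rfl, ?_⟩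
    have h2 : F p = x + step p.1 + ((k p : ℕ) : ℤ) • step p.2 + step p.2 := by
      simp only [F]; push_cast; rw [add_smul, one_smul]; abel
    rw [h2]
    exact adj_step _ _
  · have h1 := Finset.card_le_mul_card_image (f := F) Q 2 (by
      intro w hw
      obtain ⟨p, hp, rfl⟩ := Finset.mem_image.1 hw
      refine le_trans (Finset.card_le_card (t := {p, (p.2, p.1)}) ?_) Finset.card_le_two
      intro q hq
      obtain ⟨hq, hqe⟩ := Finset.mem_filter.1 hq
      simp only [F, add_assoc] at hqe
      have := step_add_smul_eq (hQ p hp).2 (hQ q hq).2 (add_left_cancel hqe).symm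
      obtain ⟨a, b⟩ := q
      obtain ⟨a', b'⟩ := p
      simpa using this)
    rw [hQcard] at h1
    have : E.card * (2 * (d - 1)) = 2 * (E.card * (d - 1)) := by ring
    omega

lemma exists_mem_not_class {o S : Set (Fin d → ℤ)} (ho : IsClass o)
    (hreg : Regular (lattice d) S) (hne : S.Nonempty) : ∃ x ∈ S, x ∉ o := by
  obtain ⟨x, hx⟩ := hne
  by_cases hxo : x ∈ o
  · obtain ⟨y, hy, hxy⟩ := hreg.1 x hx
    exact ⟨y, hy, (ho hxy).1 hxo⟩
  · exact ⟨x, hx, hxo⟩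

/-- Regularity yields a vertex of `S` off the class `o`; all its `2 * d` neighbours are in `S`, and
the outer boundary they force is counted. -/
lemma two_mul_le_ncard_edgePairs {o S : Set (Fin d → ℤ)} (ho : IsClass o) (hc : ClosedOff o S)
    (hreg : Regular (lattice d) S) (hfin : S.Finite) (hne : S.Nonempty) :
    2 * d * (d - 1) ≤ (edgePairs S).ncard := by
  obtain ⟨x, hx, hxo⟩ := exists_mem_not_class ho hreg hne
  obtain ⟨W, hW, hcard⟩ := exists_large_outer_boundary hfin (x := x) (E := Finset.univ)
    fun e _ => hc hx hxo (adj_step x e)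
  rw [Finset.card_univ, card_dir] at hcard
  have hfin' : (edgePairs Sᶜ).Finite := by
    rw [edgePairs_compl]; exact (edgePairs_finite hfin).image _
  have := card_mul_le_ncard_edgePairs hfin' (A := W) (fun w hw => (hW w hw).1) (k := 1) (by
    intro w hw
    obtain ⟨-, y, hy, hyw⟩ := hW w hw
    obtain ⟨δ, rfl⟩ := adj_iff.1 hyw.symm
    exact Finset.card_pos.2 ⟨δ, mem_outDirs.2 (not_not.2 hy)⟩)
  rw [ncard_edgePairs_compl] at this
  omega

lemma sq_le_ncard_edgePairs {o S : Set (Fin d → ℤ)} (ho : IsClass o) (hc : ClosedOff o S)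
    (hreg : Regular (lattice d) S) (hfin : S.Finite) (hne : S.Nonempty) (hd : 2 ≤ d) :
    d ^ 2 ≤ (edgePairs S).ncard := by
  refine le_trans ?_ (two_mul_le_ncard_edgePairs ho hc hreg hfin hne)
  calc d ^ 2 = d * d := sq d
    _ ≤ d * (2 * (d - 1)) := Nat.mul_le_mul_left _ (by omega)
    _ = _ := by ring

/-- From each vertex of the segment travelled in direction `δ`, a ray in direction `ε` leaves `S`
through its own boundary edge, so the segment has at most as many vertices as there are boundary
edges. This limits the starting points of the encoding to the first `n` points of a half-axis. -/
lemma exists_exit_lt {S : Set (Fin d → ℤ)} (hfin : S.Finite) {x : Fin d → ℤ} (hx : x ∈ S)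
    {δ ε : Dir d} (hδε : δ.1 ≠ ε.1) : ∃ k < (edgePairs S).ncard,
      x + (k : ℤ) • step δ ∈ S ∧ x + (k : ℤ) • step δ + step δ ∉ S := by
  classical
  obtain ⟨k, hk, hk'⟩ := exists_exit hfin hx δ
  refine ⟨k, ?_, hk k le_rfl, ?_⟩
  · have hex : ∀ j : ℕ, ∃ m : ℕ, j ≤ k → x + (j : ℤ) • step δ + (m : ℤ) • step ε ∈ S ∧
        x + (j : ℤ) • step δ + (m : ℤ) • step ε + step ε ∉ S := by
      intro j
      by_cases hj : j ≤ k
      · obtain ⟨m, hm, hm'⟩ := exists_exit hfin (hk j hj) ε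
        refine ⟨m, fun _ => ⟨hm m le_rfl, ?_⟩⟩
        push_cast at hm'
        rwa [add_smul, one_smul, ← add_assoc] at hm'
      · exact ⟨0, fun h => absurd h hj⟩
    choose m hm using hex
    rw [Set.ncard_eq_toFinset_card _ (edgePairs_finite hfin)]
    have := Finset.card_le_card_of_injOn (s := Finset.range (k + 1))
      (t := (edgePairs_finite hfin).toFinset)
      (fun j => (x + (j : ℤ) • step δ + (m j : ℤ) • step ε,
        x + (j : ℤ) • step δ + (m j : ℤ) • step ε + step ε)) (by
        intro j hj
        have hj : j < k + 1 := by simpa using hj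
        have := hm j (by omega)
        simp only [Set.Finite.coe_toFinset]
        exact ⟨this.1, this.2, adj_step _ _⟩) (by
        intro i _ j _ hij
        have h1 := congrFun (congrArg Prod.fst hij) δ.1
        simp only [Pi.add_apply, Pi.smul_apply, step_apply_of_ne (δ := ε) hδε, smul_eq_mul,
          mul_zero, add_zero, add_right_inj] at h1
        exact_mod_cast mul_right_cancel₀ (step_apply_self_ne_zero δ) h1)
    simpa using this
  · push_cast at hk'
    rwa [add_smul, one_smul, ← add_assoc] at hk'

/-! ### Greedy covers. -/

open Classical in
/-- If every element of `A` is related to at least `D` elements of `B`, then `k` greedy choices from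
`B` leave only a fraction `(1 - D / |B|) ^ k` of `A` unrelated to a chosen element. -/
lemma exists_partial_cover {α β : Type*} (A : Finset α) (B : Finset β) (R : α → β → Prop) {D : ℕ}
    (hR : ∀ a ∈ A, D ≤ (B.filter (R a)).card) (hB : D ≤ B.card) (k : ℕ) :
    ∃ U ⊆ B, U.card ≤ k ∧
      ((A.filter fun a => ∀ b ∈ U, ¬ R a b).card : ℝ) ≤ A.card * (1 - D / B.card) ^ k := by
  induction k with
  | zero =>
    refine ⟨∅, Finset.empty_subset _, le_rfl, ?_⟩
    simp
  | succ k ih =>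
    obtain ⟨U, hUB, hU, hcard⟩ := ih
    set A' := A.filter fun a => ∀ b ∈ U, ¬ R a b with hA'
    rcases B.eq_empty_or_nonempty with rfl | hBne
    · have : D = 0 := by simpa using hB
      subst this
      exact ⟨U, hUB, by omega, by simpa using hcard⟩
    have hBpos : (0 : ℝ) < B.card := by exact_mod_cast hBne.card_pos
    -- By averaging, some `b` is related to at least the fraction `D / B.card` of the elements still
    -- unrelated.
    obtain ⟨b, hb, hbc⟩ : ∃ b ∈ B, A'.card * D ≤ B.card * (A'.filter fun a => R a b).card := by
      by_contra! hcon
      have h1 : ∑ a ∈ A', (B.filter (R a)).card = ∑ b ∈ B, (A'.filter fun a => R a b).card :=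
        Finset.sum_card_bipartiteAbove_eq_sum_card_bipartiteBelow R
      have h2 : A'.card * D ≤ ∑ a ∈ A', (B.filter (R a)).card := by
        rw [← smul_eq_mul]
        exact Finset.card_nsmul_le_sum _ _ _ fun a ha => hR a (Finset.mem_filter.1 ha).1
      have h3 : ∑ b ∈ B, B.card * (A'.filter fun a => R a b).card < ∑ _b ∈ B, A'.card * D :=
        Finset.sum_lt_sum_of_nonempty hBne hcon
      rw [← Finset.mul_sum, Finset.sum_const, smul_eq_mul, ← h1] at h3
      exact absurd (Nat.lt_of_mul_lt_mul_left h3) (not_lt.2 h2)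
    refine ⟨insert b U, Finset.insert_subset hb hUB, (Finset.card_insert_le _ _).trans (by omega),
      ?_⟩
    have h1 : (A.filter fun a => ∀ c ∈ insert b U, ¬ R a c).card +
        (A'.filter fun a => R a b).card = A'.card := by
      rw [← Finset.card_filter_add_card_filter_not (s := A') (fun a => R a b), add_comm]
      congr 2
      ext a
      simp only [hA', Finset.mem_filter, Finset.forall_mem_insert]
      tauto
    have h2 : (A'.card : ℝ) * D ≤ B.card * (A'.filter fun a => R a b).card := by exact_mod_cast hbc
    have h3 : ((A.filter fun a => ∀ c ∈ insert b U, ¬ R a c).card : ℝ) +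
        (A'.filter fun a => R a b).card = A'.card := by exact_mod_cast h1
    have h4 : (A'.card : ℝ) * (D / B.card) ≤ (A'.filter fun a => R a b).card := by
      rw [mul_div_assoc', div_le_iff₀ hBpos]
      linarith
    have h5 : (0 : ℝ) ≤ 1 - D / B.card := by
      rw [sub_nonneg, div_le_one hBpos]
      exact_mod_cast hB
    calc ((A.filter fun a => ∀ c ∈ insert b U, ¬ R a c).card : ℝ)
        ≤ A'.card * (1 - D / B.card) := by linarith
      _ ≤ (A.card * (1 - D / B.card) ^ k) * (1 - D / B.card) := by gcongr
      _ = _ := by ring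

open Classical in
/-- If every element of `A` is related to at least `D` elements of `B`, then few elements of `B`
suffice to dominate `A`. -/
lemma exists_cover {α β : Type*} (A : Finset α) (B : Finset β) (R : α → β → Prop) {D : ℕ}
    (hD : 0 < D) (hR : ∀ a ∈ A, D ≤ (B.filter (R a)).card) {L : ℝ} (hL : 0 ≤ L) :
    ∃ U ⊆ B, (∀ a ∈ A, ∃ b ∈ U, R a b) ∧
      (U.card : ℝ) ≤ B.card * L / D + 1 + A.card * Real.exp (-L) := by
  rcases A.eq_empty_or_nonempty with rfl | ⟨a₀, ha₀⟩
  · exact ⟨∅, Finset.empty_subset _, by simp, by simp; positivity⟩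
  have hDB : D ≤ B.card := (hR a₀ ha₀).trans (Finset.card_filter_le _ _)
  have hBpos : (0 : ℝ) < B.card := by exact_mod_cast hD.trans_le hDB
  have hDpos : (0 : ℝ) < D := by exact_mod_cast hD
  -- This many greedy choices leave at most the fraction `exp (-L)` of `A`; the leftover elements
  -- are then covered one by one via `pick`.
  obtain ⟨U, hUB, hU, hunc⟩ := exists_partial_cover A B R hR hDB ⌈B.card * L / D⌉₊
  have hpick : ∀ a, ∃ b, a ∈ A → b ∈ B ∧ R a b := by
    intro a
    by_cases ha : a ∈ A
    · obtain ⟨b, hb⟩ := Finset.card_pos.1 (hD.trans_le (hR a ha))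
      exact ⟨b, fun _ => Finset.mem_filter.1 hb⟩
    · obtain ⟨b, hb⟩ := Finset.card_pos.1 (hD.trans_le (hR a₀ ha₀))
      exact ⟨b, fun h => absurd h ha⟩
  choose pick hpick using hpick
  set A' := A.filter fun a => ∀ b ∈ U, ¬ R a b with hA'
  refine ⟨U ∪ A'.image pick, ?_, ?_, ?_⟩
  · refine Finset.union_subset hUB fun b hb => ?_
    obtain ⟨a, ha, rfl⟩ := Finset.mem_image.1 hb
    exact (hpick a (Finset.mem_filter.1 ha).1).1
  · intro a ha
    by_cases h : ∃ b ∈ U, R a b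
    · obtain ⟨b, hb, hab⟩ := h
      exact ⟨b, Finset.mem_union_left _ hb, hab⟩
    · push Not at h
      exact ⟨pick a, Finset.mem_union_right _
        (Finset.mem_image_of_mem _ (Finset.mem_filter.2 ⟨ha, h⟩)), (hpick a ha).2⟩
  · have h1 : ((U ∪ A'.image pick).card : ℝ) ≤ U.card + A'.card := by
      exact_mod_cast (Finset.card_union_le _ _).trans (add_le_add le_rfl Finset.card_image_le)
    have h2 : (U.card : ℝ) ≤ B.card * L / D + 1 :=
      (Nat.cast_le.2 hU).trans (Nat.ceil_lt_add_one (by positivity)).le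
    have h3 : (1 - (D : ℝ) / B.card) ^ ⌈B.card * L / D⌉₊ ≤ Real.exp (-L) := by
      have h4 : 1 - (D : ℝ) / B.card ≤ Real.exp (-(D / B.card)) := by
        have := Real.add_one_le_exp (-((D : ℝ) / B.card))
        linarith
      have h5 : (0 : ℝ) ≤ 1 - D / B.card := by
        rw [sub_nonneg, div_le_one hBpos]
        exact_mod_cast hDB
      refine (pow_le_pow_left₀ h5 h4 _).trans ?_
      rw [← Real.exp_nat_mul, Real.exp_le_exp, mul_neg, neg_le_neg_iff]
      calc L = (B.card * L / D) * (D / B.card) := by field_simp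
        _ ≤ _ := by gcongr; exact Nat.le_ceil _
    have h4 : (A'.card : ℝ) ≤ A.card * Real.exp (-L) := hunc.trans (by gcongr)
    linarith

/-! ### Dominating and separating sets. -/

/-- The vertices of `S` incident to at least `d` boundary edges are dominated by few vertices. -/
lemma exists_dominating {o S : Set (Fin d → ℤ)} (ho : IsClass o) (hc : ClosedOff o S)
    (hreg : Regular (lattice d) S) (hfin : (edgePairs S).Finite) (hd : 2 ≤ d) {s : ℕ} (hs : 1 ≤ s)
    (hsd : s ≤ d) : ∃ U : Finset (Fin d → ℤ),
      (∀ u ∈ S, d ≤ (outDirs S u).card → ∃ w ∈ U, (lattice d).Adj w u) ∧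
      (∀ w ∈ U, ∃ p ∈ edgePairs S, (lattice d).Adj w p.1) ∧
      (U.card : ℝ) ≤ (edgePairs S).ncard / s * Real.log d / (d / 2) + 1 +
        (edgePairs S).ncard / d / d + 2 * s * (edgePairs S).ncard / d ^ 2 := by
  classical
  have hfin' : (edgePairs Sᶜ).Finite := by
    rw [edgePairs_compl]; exact hfin.image _
  set n := (edgePairs S).ncard with hn
  let Pb : Finset (Fin d → ℤ) := hfin.toFinset.image Prod.fst
  let Qb : Finset (Fin d → ℤ) := hfin.toFinset.image Prod.snd
  have hPb : ∀ u δ, u ∈ S → u + step δ ∉ S → u ∈ Pb := by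
    intro u δ hu hδ
    exact Finset.mem_image.2 ⟨(u, u + step δ), by simpa using ⟨hu, hδ, adj_step _ _⟩, rfl⟩
  have hQb : ∀ u δ, u ∈ S → u + step δ ∉ S → u + step δ ∈ Qb := by
    intro u δ hu hδ
    exact Finset.mem_image.2 ⟨(u, u + step δ), by simpa using ⟨hu, hδ, adj_step _ _⟩, rfl⟩
  have hPb' : ∀ u ∈ Pb, ∃ v, (u, v) ∈ edgePairs S := by
    intro u hu
    obtain ⟨⟨u, v⟩, h, rfl⟩ := Finset.mem_image.1 hu
    exact ⟨v, by simpa using h⟩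
  have hQb' : ∀ v ∈ Qb, ∃ u, (u, v) ∈ edgePairs S := by
    intro u hu
    obtain ⟨⟨u, v⟩, h, rfl⟩ := Finset.mem_image.1 hu
    exact ⟨u, by simpa using h⟩
  -- The outer neighbours of `u` are split by whether they have at least `s` neighbours in `S`. If
  -- many do, `u` is handled by a greedy cover from the small set `B`; otherwise closedness produces
  -- many vertices in `P'`, which have fewer than `s` neighbours in `S`.
  let low : (Fin d → ℤ) → Finset (Dir d) := fun u =>
    (outDirs S u).filter fun δ => ¬ s ≤ (outDirs Sᶜ (u + step δ)).card
  let high : (Fin d → ℤ) → Finset (Dir d) := fun u =>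
    (outDirs S u).filter fun δ => s ≤ (outDirs Sᶜ (u + step δ)).card
  have hlh : ∀ u, (high u).card + (low u).card = (outDirs S u).card := fun u =>
    Finset.card_filter_add_card_filter_not _
  let A := Pb.filter fun u => d ≤ (outDirs S u).card ∧ d ≤ 2 * (high u).card
  let B := Qb.filter fun v => s ≤ (outDirs Sᶜ v).card
  let P' := Pb.filter fun u => 2 * d < (outDirs S u).card + s
  have hPbS : ∀ u ∈ Pb, u ∈ S := fun u hu => (hPb' u hu).choose_spec.1
  have hA : A.card * d ≤ n :=
    card_mul_le_ncard_edgePairs hfin (fun a ha => hPbS a (Finset.mem_filter.1 ha).1)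
      fun a ha => (Finset.mem_filter.1 ha).2.1
  have hB : B.card * s ≤ n := by
    rw [hn, ← ncard_edgePairs_compl]
    refine card_mul_le_ncard_edgePairs hfin' (fun v hv => ?_)
      fun a ha => (Finset.mem_filter.1 ha).2
    obtain ⟨u, hu⟩ := hQb' v (Finset.mem_filter.1 hv).1
    exact hu.2.1
  have hP' : P'.card * d ≤ n := by
    refine card_mul_le_ncard_edgePairs hfin (fun a ha => hPbS a (Finset.mem_filter.1 ha).1)
      fun a ha => ?_
    have := (Finset.mem_filter.1 ha).2
    omega
  let cand : Finset (Fin d → ℤ) := (P' ×ˢ (Finset.univ : Finset (Dir d))).image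
    fun p => p.1 + step p.2
  let Wst := cand.filter fun w => w ∈ S ∧ d ≤ 2 * (P'.filter ((lattice d).Adj w)).card
  -- Double counting of adjacencies: each `w` in `Wst` has at least `d / 2` neighbours in `P'`,
  -- while each vertex of `P'` has fewer than `s` neighbours in `S`.
  have hWst : Wst.card * d ≤ 2 * (P'.card * s) := by
    have h1 : ∑ w ∈ Wst, (P'.filter ((lattice d).Adj w)).card =
        ∑ u ∈ P', (Wst.filter fun w => (lattice d).Adj w u).card :=
      Finset.sum_card_bipartiteAbove_eq_sum_card_bipartiteBelow (lattice d).Adj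
    have h2 : Wst.card * d ≤ ∑ w ∈ Wst, 2 * (P'.filter ((lattice d).Adj w)).card := by
      rw [← smul_eq_mul]
      exact Finset.card_nsmul_le_sum _ _ _ fun w hw => (Finset.mem_filter.1 hw).2.2
    have h3 : ∑ u ∈ P', (Wst.filter fun w => (lattice d).Adj w u).card ≤ P'.card * s := by
      rw [← smul_eq_mul]
      refine Finset.sum_le_card_nsmul _ _ _ fun u hu => ?_
      have h4 : (Wst.filter fun w => (lattice d).Adj w u).card ≤ (outDirs Sᶜ u).card := by
        refine (Finset.card_le_card (t := (outDirs Sᶜ u).image fun δ => u + step δ) ?_).trans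
          Finset.card_image_le
        intro w hw
        obtain ⟨hw, hwu⟩ := Finset.mem_filter.1 hw
        obtain ⟨δ, rfl⟩ := adj_iff.1 hwu.symm
        exact Finset.mem_image_of_mem _
          (mem_outDirs.2 (not_not.2 (Finset.mem_filter.1 hw).2.1))
      have h5 := card_outDirs_add S u
      have h6 := (Finset.mem_filter.1 hu).2
      omega
    rw [← Finset.mul_sum, h1] at h2
    omega
  obtain ⟨D, hD1, hD2⟩ : ∃ D : ℕ, d ≤ 2 * D ∧ 2 * D ≤ d + 1 := ⟨(d + 1) / 2, by omega, by omega⟩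
  have hd1 : (1 : ℝ) ≤ d := by exact_mod_cast (by omega : 1 ≤ d)
  obtain ⟨Ua, hUaB, hUa, hUac⟩ := exists_cover A B (fun a b => (lattice d).Adj b a) (D := D)
    (by omega) (by
      intro u hu
      obtain ⟨huP, hu1, hu2⟩ := Finset.mem_filter.1 hu
      have h1 : D ≤ (high u).card := by omega
      refine h1.trans ?_
      refine Finset.card_le_card_of_injOn (fun δ => u + step δ) ?_
        (fun a _ b _ h => step_injective (add_left_cancel h))
      intro δ hδ
      obtain ⟨hδ1, hδ2⟩ := Finset.mem_filter.1 hδ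
      have hδ3 := hQb u δ (hPbS u huP) (mem_outDirs.1 hδ1)
      simp only [Finset.coe_filter, Set.mem_ofPred_eq]
      exact ⟨Finset.mem_filter.2 ⟨hδ3, hδ2⟩, (adj_step u δ).symm⟩) (Real.log_nonneg hd1)
  refine ⟨Ua ∪ Wst, ?_, ?_, ?_⟩
  · intro u hu hud
    obtain ⟨δ, hδ⟩ : (outDirs S u).Nonempty := Finset.card_pos.1 (by omega)
    have huP : u ∈ Pb := hPb u δ hu (mem_outDirs.1 hδ)
    by_cases hh : d ≤ 2 * (high u).card
    · obtain ⟨b, hb, hbu⟩ := hUa u (Finset.mem_filter.2 ⟨huP, hud, hh⟩)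
      exact ⟨b, Finset.mem_union_left _ hb, hbu⟩
    have hl : d ≤ 2 * (low u).card := by have := hlh u; omega
    have huo : u ∈ o := by
      by_contra huo
      exact mem_outDirs.1 hδ (hc hu huo (adj_step _ _))
    obtain ⟨w, hw, huw⟩ := hreg.1 u hu
    have hwo : w ∉ o := (ho huw).1 huo
    obtain ⟨ε, rfl⟩ := adj_iff.1 huw
    -- The neighbour `u + step ε` is in `S` off the class, so its translate by `step δ` is in `S`
    -- too. That translate is adjacent to `u + step δ`, which has fewer than `s` neighbours in `S`,
    -- hence it has more than `2 * d - s` outside.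
    have hlow : ∀ δ ∈ low u, u + step ε + step δ ∈ P' := by
      intro δ hδ
      obtain ⟨hδ1, hδ2⟩ := Finset.mem_filter.1 hδ
      have h1 : u + step ε + step δ ∈ S := hc hw hwo (adj_step _ _)
      have h2 : (lattice d).Adj (u + step ε + step δ) (u + step δ) := by
        have := (adj_step (u + step δ) ε).symm
        rwa [add_right_comm] at this
      have h3 := two_mul_le_card_outDirs_add ho hc h1 (mem_outDirs.1 hδ1) h2
      obtain ⟨η, hη⟩ := adj_iff.1 h2
      refine Finset.mem_filter.2 ⟨hPb _ η h1 (hη ▸ mem_outDirs.1 hδ1), by omega⟩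
    have huP' : u ∈ P' := by
      obtain ⟨δ, hδ⟩ : (low u).Nonempty := Finset.card_pos.1 (by omega)
      obtain ⟨hδ1, hδ2⟩ := Finset.mem_filter.1 hδ
      have := two_mul_le_card_outDirs_add ho hc hu (mem_outDirs.1 hδ1) (adj_step _ _)
      exact Finset.mem_filter.2 ⟨huP, by omega⟩
    refine ⟨u + step ε, Finset.mem_union_right _ (Finset.mem_filter.2 ⟨?_, hw, ?_⟩), huw.symm⟩
    · exact Finset.mem_image.2 ⟨(u, ε), by simp [huP'], rfl⟩
    · refine hl.trans (Nat.mul_le_mul_left _ ?_)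
      refine Finset.card_le_card_of_injOn (fun δ => u + step ε + step δ) ?_
        (fun a _ b _ h => step_injective (add_left_cancel h))
      intro δ hδ
      simp only [Finset.coe_filter, Set.mem_ofPred_eq]
      exact ⟨hlow δ hδ, adj_step _ _⟩
  · intro w hw
    rcases Finset.mem_union.1 hw with hw | hw
    · obtain ⟨u, hu⟩ := hQb' w (Finset.mem_filter.1 (hUaB hw)).1
      exact ⟨(u, w), hu, hu.2.2.symm⟩
    · obtain ⟨u, hu⟩ : (P'.filter ((lattice d).Adj w)).Nonempty := by
        have := (Finset.mem_filter.1 hw).2.2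
        exact Finset.card_pos.1 (by omega)
      obtain ⟨hu, hwu⟩ := Finset.mem_filter.1 hu
      obtain ⟨v, hv⟩ := hPb' u (Finset.mem_filter.1 hu).1
      exact ⟨(u, v), hv, hwu⟩
  · have hdpos : (0 : ℝ) < d := by linarith
    have hspos : (0 : ℝ) < s := by exact_mod_cast hs
    have e1 : (B.card : ℝ) ≤ n / s := by
      rw [le_div_iff₀ hspos]; exact_mod_cast hB
    have e2 : (A.card : ℝ) ≤ n / d := by
      rw [le_div_iff₀ hdpos]; exact_mod_cast hA
    have e3 : (Wst.card : ℝ) ≤ 2 * s * n / d ^ 2 := by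
      rw [le_div_iff₀ (by positivity)]
      have : Wst.card * d ^ 2 ≤ 2 * s * n := by
        calc Wst.card * d ^ 2 = Wst.card * d * d := by ring
          _ ≤ 2 * (P'.card * s) * d := Nat.mul_le_mul_right _ hWst
          _ = 2 * s * (P'.card * d) := by ring
          _ ≤ 2 * s * n := Nat.mul_le_mul_left _ hP'
      exact_mod_cast this
    have e4 : ((Ua ∪ Wst).card : ℝ) ≤ Ua.card + Wst.card := by
      exact_mod_cast Finset.card_union_le _ _
    have e5 : (d : ℝ) / 2 ≤ D := by
      rw [div_le_iff₀ (by norm_num)]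
      exact_mod_cast (by omega : d ≤ D * 2)
    have e6 : (B.card : ℝ) * Real.log d / D ≤ n / s * Real.log d / (d / 2) := by
      have := Real.log_nonneg hd1
      gcongr
    have e7 : (A.card : ℝ) * Real.exp (-Real.log d) ≤ n / d / d := by
      rw [Real.exp_neg, Real.exp_log hdpos, div_eq_mul_inv (_ / _)]
      gcongr
    linarith

/-- The natural scale `√(d log d)`. -/
noncomputable def scale (d : ℕ) : ℝ := Real.sqrt (d * Real.log d)

lemma one_le_scale (hd : 2 ≤ d) : 1 ≤ scale d := by
  have h1 : (2 : ℝ) ≤ d := by exact_mod_cast hd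
  have h2 : Real.log 2 ≤ Real.log d := Real.log_le_log (by norm_num) h1
  have h3 := Real.log_two_gt_d9
  refine Real.one_le_sqrt.2 ?_
  nlinarith

lemma scale_sq (hd : 2 ≤ d) : scale d ^ 2 = d * Real.log d := by
  have h1 : (1 : ℝ) ≤ d := by exact_mod_cast (by omega : 1 ≤ d)
  exact Real.sq_sqrt (mul_nonneg (by linarith) (Real.log_nonneg h1))

lemma scale_le (hd : 2 ≤ d) : scale d ≤ d := by
  have h1 : (2 : ℝ) ≤ d := by exact_mod_cast hd
  have h2 := Real.log_le_sub_one_of_pos (by linarith : (0 : ℝ) < d)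
  refine Real.sqrt_le_left (by linarith) |>.2 ?_
  nlinarith

/-- A set `S` closed off a class is separated by the neighbourhoods of few vertices. -/
lemma exists_separating {o S : Set (Fin d → ℤ)} (ho : IsClass o) (hc : ClosedOff o S)
    (hreg : Regular (lattice d) S) (hfin : (edgePairs S).Finite) (hd : 2 ≤ d)
    (hn : d ^ 2 ≤ (edgePairs S).ncard) : ∃ U : Finset (Fin d → ℤ),
      (∀ p ∈ edgePairs S, ∃ w ∈ U, (lattice d).Adj w p.1 ∨ (lattice d).Adj w p.2) ∧
      (∀ w ∈ U, ∃ p ∈ edgePairs S, l1 (w - p.1) ≤ 2) ∧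
      (U.card : ℝ) ≤ 16 * ((edgePairs S).ncard * scale d / d ^ 2) := by
  classical
  have hq1 := one_le_scale hd
  have hqd := scale_le hd
  -- The choice `s = ⌈scale d⌉` balances the terms `n log d / (s d)` and `s n / d²` of the
  -- domination bound.
  have hs1 : 1 ≤ ⌈scale d⌉₊ := Nat.one_le_ceil_iff.2 (by linarith)
  have hsd : ⌈scale d⌉₊ ≤ d := Nat.ceil_le.2 hqd
  have hfin' : (edgePairs Sᶜ).Finite := by
    rw [edgePairs_compl]; exact hfin.image _
  obtain ⟨U, hU1, hU2, hU3⟩ := exists_dominating ho hc hreg hfin hd hs1 hsd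
  obtain ⟨U', hU1', hU2', hU3'⟩ :=
    exists_dominating ho.compl (hc.compl ho) hreg.compl hfin' hd hs1 hsd
  rw [ncard_edgePairs_compl] at hU3'
  refine ⟨U ∪ U', ?_, ?_, ?_⟩
  · rintro ⟨u, v⟩ ⟨hu, hv, huv⟩
    simp only at hu hv huv
    have h := two_mul_le_card_outDirs_add ho hc hu hv huv
    rcases le_or_gt d (outDirs S u).card with h1 | h1
    · obtain ⟨w, hw, hwu⟩ := hU1 u hu h1
      exact ⟨w, Finset.mem_union_left _ hw, Or.inl hwu⟩
    · obtain ⟨w, hw, hwu⟩ := hU1' v hv (by omega)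
      exact ⟨w, Finset.mem_union_right _ hw, Or.inr hwu⟩
  · intro w hw
    rcases Finset.mem_union.1 hw with hw | hw
    · obtain ⟨p, hp, hwp⟩ := hU2 w hw
      exact ⟨p, hp, by rw [l1_of_adj hwp]; norm_num⟩
    · obtain ⟨p, hp, hwp⟩ := hU2' w hw
      rw [edgePairs_compl] at hp
      obtain ⟨q, hq, rfl⟩ := hp
      refine ⟨q, hq, (l1_sub_le _ q.2 _).trans ?_⟩
      have h1 : l1 (w - q.2) = 1 := l1_of_adj hwp
      have h2 : l1 (q.2 - q.1) = 1 := l1_of_adj hq.2.2.symm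
      omega
  · set n : ℝ := ((edgePairs S).ncard : ℝ) with hn'
    set q := scale d with hq
    have hn2 : (d : ℝ) ^ 2 ≤ n := by rw [hn']; exact_mod_cast hn
    have hdpos : (0 : ℝ) < d := by exact_mod_cast (by omega : 0 < d)
    have hlog : Real.log d = q ^ 2 / d := by
      rw [hq, scale_sq hd]; field_simp
    have hsq : q ≤ (⌈q⌉₊ : ℝ) := Nat.le_ceil _
    have hsq2 : (⌈q⌉₊ : ℝ) ≤ 2 * q := by
      have := Nat.ceil_lt_add_one (by linarith : (0 : ℝ) ≤ q)
      linarith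
    have hn0 : 0 < n := lt_of_lt_of_le (by positivity) hn2
    have e1 : n / (⌈q⌉₊ : ℝ) * Real.log d / (d / 2) ≤ 2 * (n * q / d ^ 2) := by
      rw [hlog]
      calc n / (⌈q⌉₊ : ℝ) * (q ^ 2 / d) / (d / 2) ≤ n / q * (q ^ 2 / d) / (d / 2) := by gcongr
        _ = _ := by field_simp
    have e2 : (1 : ℝ) ≤ n * q / d ^ 2 := by
      rw [le_div_iff₀ (by positivity)]
      nlinarith
    have e3 : n / d / d ≤ n * q / d ^ 2 := by
      rw [div_div, ← sq]
      gcongr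
      nlinarith
    have e4 : 2 * (⌈q⌉₊ : ℝ) * n / d ^ 2 ≤ 4 * (n * q / d ^ 2) := by
      calc 2 * (⌈q⌉₊ : ℝ) * n / d ^ 2 ≤ 2 * (2 * q) * n / d ^ 2 := by gcongr
        _ = _ := by ring
    have e5 : ((U ∪ U').card : ℝ) ≤ U.card + U'.card := by
      exact_mod_cast Finset.card_union_le _ _
    linarith

/-! ### Components off the separating set. -/

open Classical in
/-- The neighbours of a finite set of vertices. -/
noncomputable def nbrs (U : Finset (Fin d → ℤ)) : Finset (Fin d → ℤ) :=
  (U ×ˢ (Finset.univ : Finset (Dir d))).image fun p => p.1 + step p.2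

lemma mem_nbrs {U : Finset (Fin d → ℤ)} {x : Fin d → ℤ} :
    x ∈ nbrs U ↔ ∃ w ∈ U, (lattice d).Adj w x := by
  simp only [nbrs, Finset.mem_image, Finset.mem_product, Finset.mem_univ, and_true, adj_iff]
  constructor
  · rintro ⟨⟨w, δ⟩, hw, rfl⟩
    exact ⟨w, hw, δ, rfl⟩
  · rintro ⟨w, hw, δ, rfl⟩
    exact ⟨(w, δ), hw, rfl⟩

lemma card_nbrs_le (U : Finset (Fin d → ℤ)) : (nbrs U).card ≤ 2 * d * U.card := by
  refine Finset.card_image_le.trans ?_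
  rw [Finset.card_product, Finset.card_univ, card_dir, mul_comm]

/-- `x` and `y` are joined by a lattice path avoiding `W`. -/
def Linked (W : Set (Fin d → ℤ)) : (Fin d → ℤ) → (Fin d → ℤ) → Prop :=
  Relation.ReflTransGen fun x y => (lattice d).Adj x y ∧ x ∉ W ∧ y ∉ W

lemma Linked.symm {W : Set (Fin d → ℤ)} {x y : Fin d → ℤ} (h : Linked W x y) : Linked W y x := by
  have hs : Std.Symm (fun x y : Fin d → ℤ => (lattice d).Adj x y ∧ x ∉ W ∧ y ∉ W) :=
    ⟨fun x y h => ⟨h.1.symm, h.2.2, h.2.1⟩⟩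
  exact Relation.ReflTransGen.stdSymm.symm _ _ h

lemma Linked.trans {W : Set (Fin d → ℤ)} {x y z : Fin d → ℤ} (h : Linked W x y)
    (h' : Linked W y z) : Linked W x z :=
  Relation.ReflTransGen.trans h h'

lemma Linked.notMem {W : Set (Fin d → ℤ)} {x y : Fin d → ℤ} (h : Linked W x y) (hx : x ∉ W) :
    y ∉ W := by
  induction h with
  | refl => exact hx
  | tail _ h _ => exact h.2.2

/-- Vertices joined by a path that avoids a separating set are on the same side. -/
lemma Linked.mem {W S : Set (Fin d → ℤ)} (hsep : ∀ p ∈ edgePairs S, p.1 ∈ W ∨ p.2 ∈ W)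
    {x y : Fin d → ℤ} (h : Linked W x y) (hx : x ∈ S) : y ∈ S := by
  induction h with
  | refl => exact hx
  | @tail b c _ h ih =>
    by_contra hc
    rcases hsep (b, c) ⟨ih, hc, h.1⟩ with h' | h'
    · exact h.2.1 h'
    · exact h.2.2 h'

/-- `y` is linked to a vertex having at least `d` neighbours outside `W`. -/
def IsLarge (W : Set (Fin d → ℤ)) (y : Fin d → ℤ) : Prop :=
  ∃ z, Linked W y z ∧ d ≤ (outDirs W z).card

/-- The vertices linked to `R`. -/
def linkedTo (W R : Set (Fin d → ℤ)) : Set (Fin d → ℤ) :=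
  {y | y ∉ W ∧ ∃ x ∈ R, Linked W x y}

/-- The vertices in large components of `Wᶜ` not meeting `R`. -/
def largeNotLinkedTo (W R : Set (Fin d → ℤ)) : Set (Fin d → ℤ) :=
  {y | y ∉ W ∧ IsLarge W y ∧ y ∉ linkedTo W R}

/-- Outside of `W` and of the large components there are few vertices. -/
lemma exists_finset_undetermined (U : Finset (Fin d → ℤ)) (R : Set (Fin d → ℤ)) (hd : 2 ≤ d) :
    ∃ X : Finset (Fin d → ℤ),
      (∀ x, x ∉ linkedTo (nbrs U : Set (Fin d → ℤ)) R ∪ largeNotLinkedTo (nbrs U) R → x ∈ X) ∧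
      (∀ x ∈ X, ∃ u ∈ U, l1 (x - u) ≤ 2) ∧ X.card ≤ 6 * d * U.card := by
  classical
  let Y := (nbrs (nbrs U)).filter fun y => y ∉ nbrs U ∧ (outDirs (nbrs U : Set (Fin d → ℤ)) y).card < d
  refine ⟨nbrs U ∪ Y, ?_, ?_, ?_⟩
  · intro x hx
    rw [Finset.mem_union]
    by_cases hxW : x ∈ nbrs U
    · exact Or.inl hxW
    · refine Or.inr (Finset.mem_filter.2 ?_)
      have hlt : (outDirs (nbrs U : Set (Fin d → ℤ)) x).card < d := by
        by_contra hge
        refine hx ?_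
        by_cases hl : x ∈ linkedTo (nbrs U : Set (Fin d → ℤ)) R
        · exact Or.inl hl
        · exact Or.inr ⟨hxW, ⟨x, Relation.ReflTransGen.refl, not_lt.1 hge⟩, hl⟩
      refine ⟨?_, hxW, hlt⟩
      have h1 := card_outDirs_add (nbrs U : Set (Fin d → ℤ)) x
      obtain ⟨δ, hδ⟩ : (outDirs (nbrs U : Set (Fin d → ℤ))ᶜ x).Nonempty :=
        Finset.card_pos.1 (by omega)
      exact mem_nbrs.2 ⟨x + step δ, by simpa using not_not.1 (mem_outDirs.1 hδ),
        (adj_step _ _).symm⟩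
  · intro x hx
    rcases Finset.mem_union.1 hx with hx | hx
    · obtain ⟨w, hw, hwx⟩ := mem_nbrs.1 hx
      exact ⟨w, hw, by rw [l1_of_adj hwx.symm]; norm_num⟩
    · obtain ⟨y, hy, hyx⟩ := mem_nbrs.1 (Finset.mem_filter.1 hx).1
      obtain ⟨w, hw, hwy⟩ := mem_nbrs.1 hy
      refine ⟨w, hw, (l1_sub_le x y w).trans ?_⟩
      rw [l1_of_adj hwy.symm, l1_of_adj hyx.symm]
  · have h1 : ∑ y ∈ Y, ((nbrs U).filter ((lattice d).Adj y)).card =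
        ∑ w ∈ nbrs U, (Y.filter fun y => (lattice d).Adj y w).card :=
      Finset.sum_card_bipartiteAbove_eq_sum_card_bipartiteBelow (lattice d).Adj
    have h2 : Y.card * d ≤ ∑ y ∈ Y, ((nbrs U).filter ((lattice d).Adj y)).card := by
      rw [← smul_eq_mul]
      refine Finset.card_nsmul_le_sum _ _ _ fun y hy => ?_
      have h3 := (Finset.mem_filter.1 hy).2.2
      have h4 := card_outDirs_add (nbrs U : Set (Fin d → ℤ)) y
      refine le_trans (b := (outDirs (nbrs U : Set (Fin d → ℤ))ᶜ y).card) (by omega) ?_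
      refine Finset.card_le_card_of_injOn (fun δ => y + step δ) ?_
        (fun a _ b _ h => step_injective (add_left_cancel h))
      intro δ hδ
      simp only [Finset.coe_filter, Set.mem_ofPred_eq]
      exact ⟨by simpa using not_not.1 (mem_outDirs.1 hδ), adj_step _ _⟩
    have h5 : ∑ w ∈ nbrs U, (Y.filter fun y => (lattice d).Adj y w).card ≤
        (nbrs U).card * (2 * d) := by
      rw [← smul_eq_mul]
      refine Finset.sum_le_card_nsmul _ _ _ fun w _ => ?_
      rw [← card_dir, ← Finset.card_univ]
      refine (Finset.card_le_card (t := Finset.univ.image fun δ => w + step δ) ?_).trans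
        Finset.card_image_le
      intro y hy
      obtain ⟨δ, rfl⟩ := adj_iff.1 (Finset.mem_filter.1 hy).2.symm
      exact Finset.mem_image_of_mem _ (Finset.mem_univ _)
    -- Each vertex of `Y` has more than `d` of its `2 * d` neighbours in `nbrs U`, while a vertex of
    -- `nbrs U` has only `2 * d` neighbours.
    have h6 : Y.card ≤ 2 * (nbrs U).card := by
      refine Nat.le_of_mul_le_mul_right (c := d) ?_ (by omega)
      calc Y.card * d ≤ (nbrs U).card * (2 * d) := by omega
        _ = _ := by ring
    have h7 := card_nbrs_le U
    have h8 := Finset.card_union_le (nbrs U) Y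
    have h9 : 6 * d * U.card = 3 * (2 * d * U.card) := by ring
    omega

/-- The large components inside `S` have few representatives, all near the separating set. -/
lemma exists_representatives {S : Set (Fin d → ℤ)} (hfin : S.Finite) (hd : 2 ≤ d)
    {U : Finset (Fin d → ℤ)}
    (hsep : ∀ p ∈ edgePairs S, p.1 ∈ nbrs U ∨ p.2 ∈ nbrs U) :
    ∃ R : Finset (Fin d → ℤ),
      linkedTo (nbrs U : Set (Fin d → ℤ)) (R : Set (Fin d → ℤ)) ⊆ S ∧
      largeNotLinkedTo (nbrs U : Set (Fin d → ℤ)) (R : Set (Fin d → ℤ)) ⊆ Sᶜ ∧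
      (∀ x ∈ R, ∃ u ∈ U, l1 (x - u) ≤ 2) ∧ R.card ≤ 8 * U.card := by
  classical
  set W : Set (Fin d → ℤ) := (nbrs U : Set (Fin d → ℤ)) with hW
  have hsep' : ∀ p ∈ edgePairs S, p.1 ∈ W ∨ p.2 ∈ W := hsep
  let comp : (Fin d → ℤ) → Set (Fin d → ℤ) := fun z => {y | Linked W z y}
  have hcomp : ∀ {z y}, Linked W z y → comp z = comp y := by
    intro z y h
    ext v
    exact ⟨fun hv => h.symm.trans hv, fun hv => h.trans hv⟩
  let Z : Finset (Fin d → ℤ) := hfin.toFinset.filter fun z => z ∉ W ∧ d ≤ (outDirs W z).card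
  have hZ : ∀ z, z ∈ Z ↔ z ∈ S ∧ z ∉ W ∧ d ≤ (outDirs W z).card := by
    intro z; simp [Z]
  -- A large component inside `S` is finite, and its outer boundary lies in `W`; the isoperimetric
  -- lemma applies to the neighbours of `z` outside `W`.
  have hbd : ∀ z ∈ Z, d * (d - 1) ≤
      ((nbrs U).filter fun w => ∃ y ∈ comp z, (lattice d).Adj y w).card := by
    intro z hz
    obtain ⟨hzS, hzW, hzd⟩ := (hZ z).1 hz
    have hB : (comp z).Finite := hfin.subset fun y hy => Linked.mem hsep' hy hzS
    obtain ⟨V, hV, hVc⟩ := exists_large_outer_boundary hB (x := z) (E := outDirs W z) (by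
      intro e he
      exact Relation.ReflTransGen.single ⟨adj_step _ _, hzW, mem_outDirs.1 he⟩)
    refine (Nat.mul_le_mul_right _ hzd).trans (hVc.trans (Finset.card_le_card fun w hw => ?_))
    obtain ⟨hw1, y, hy, hyw⟩ := hV w hw
    refine Finset.mem_filter.2 ⟨?_, y, hy, hyw⟩
    by_contra hwW
    exact hw1 (Relation.ReflTransGen.tail hy ⟨hyw, Linked.notMem hy hzW, by simpa [hW] using hwW⟩)
  have hd1 : 0 < d * (d - 1) := Nat.mul_pos (by omega) (by omega)
  -- The representative depends on the component as a set, so equal components share it. It is taken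
  -- next to `W` to stay close to `U`; the value `0` is never used for a large component.
  let rep : Set (Fin d → ℤ) → (Fin d → ℤ) := fun B =>
    if h : ∃ y ∈ B, ∃ w ∈ W, (lattice d).Adj y w then h.choose else 0
  have hrep : ∀ z ∈ Z, rep (comp z) ∈ comp z ∧ ∃ w ∈ W, (lattice d).Adj (rep (comp z)) w := by
    intro z hz
    obtain ⟨w, hw⟩ := Finset.card_pos.1 (hd1.trans_le (hbd z hz))
    obtain ⟨hwW, y, hy, hyw⟩ := Finset.mem_filter.1 hw
    have h : ∃ y ∈ comp z, ∃ w ∈ W, (lattice d).Adj y w := ⟨y, hy, w, by simpa [hW] using hwW, hyw⟩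
    simp only [rep, dif_pos h]
    exact h.choose_spec
  let R : Finset (Fin d → ℤ) := Z.image fun z => rep (comp z)
  have hR : ∀ x ∈ R, ∃ z ∈ Z, x = rep (comp z) ∧ comp z = comp x := by
    intro x hx
    obtain ⟨z, hz, rfl⟩ := Finset.mem_image.1 hx
    exact ⟨z, hz, rfl, hcomp (hrep z hz).1⟩
  have hRS : linkedTo W (R : Set (Fin d → ℤ)) ⊆ S := by
    rintro y ⟨-, x, hx, hxy⟩
    obtain ⟨z, hz, rfl, -⟩ := hR x hx
    exact Linked.mem hsep' ((hrep z hz).1.trans hxy) ((hZ z).1 hz).1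
  refine ⟨R, hRS, ?_, ?_, ?_⟩
  · rintro y ⟨hyW, ⟨z, hyz, hzd⟩, hyR⟩ hyS
    refine hyR ⟨hyW, rep (comp z), ?_, ?_⟩
    · exact Finset.mem_image_of_mem _
        ((hZ z).2 ⟨Linked.mem hsep' hyz hyS, Linked.notMem hyz hyW, hzd⟩)
    · have hz : z ∈ Z := (hZ z).2 ⟨Linked.mem hsep' hyz hyS, Linked.notMem hyz hyW, hzd⟩
      exact (hrep z hz).1.symm.trans hyz.symm
  · intro x hx
    obtain ⟨z, hz, rfl, -⟩ := hR x hx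
    obtain ⟨-, w, hw, hxw⟩ := hrep z hz
    obtain ⟨u, hu, huw⟩ := mem_nbrs.1 (by simpa [hW] using hw)
    refine ⟨u, hu, (l1_sub_le _ w _).trans ?_⟩
    rw [l1_of_adj hxw, l1_of_adj huw.symm]
  · have h1 : ∑ x ∈ R, ((nbrs U).filter fun w => ∃ y ∈ comp x, (lattice d).Adj y w).card =
        ∑ w ∈ nbrs U, (R.filter fun x => ∃ y ∈ comp x, (lattice d).Adj y w).card :=
      Finset.sum_card_bipartiteAbove_eq_sum_card_bipartiteBelow _
    have h2 : R.card * (d * (d - 1)) ≤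
        ∑ x ∈ R, ((nbrs U).filter fun w => ∃ y ∈ comp x, (lattice d).Adj y w).card := by
      rw [← smul_eq_mul]
      refine Finset.card_nsmul_le_sum _ _ _ fun x hx => ?_
      obtain ⟨z, hz, -, hzx⟩ := hR x hx
      rw [← hzx]
      exact hbd z hz
    have h3 : ∑ w ∈ nbrs U, (R.filter fun x => ∃ y ∈ comp x, (lattice d).Adj y w).card ≤
        (nbrs U).card * (2 * d) := by
      rw [← smul_eq_mul]
      refine Finset.sum_le_card_nsmul _ _ _ fun w _ => ?_
      rw [← card_dir, ← Finset.card_univ]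
      -- A vertex `w` touches at most `2 * d` components, since a direction from `w` leads into at
      -- most one.
      have hdir : ∀ x, ∃ δ : Dir d, (x ∈ R.filter fun x => ∃ y ∈ comp x, (lattice d).Adj y w) →
          w + step δ ∈ comp x := by
        intro x
        by_cases hx : x ∈ R.filter fun x => ∃ y ∈ comp x, (lattice d).Adj y w
        · obtain ⟨y, hy, hyw⟩ := (Finset.mem_filter.1 hx).2
          obtain ⟨δ, rfl⟩ := adj_iff.1 hyw.symm
          exact ⟨δ, fun _ => hy⟩
        · exact ⟨(⟨0, by omega⟩, true), fun h => absurd h hx⟩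
      choose f hf using hdir
      refine Finset.card_le_card_of_injOn f (fun _ _ => Finset.mem_univ _) ?_
      intro x hx x' hx' hxx'
      have a1 := hf x hx
      have a2 := hf x' hx'
      rw [← hxx'] at a2
      have a3 : comp x = comp x' := (hcomp a1).trans (hcomp a2).symm
      obtain ⟨z, -, b1, b2⟩ := hR x (Finset.mem_filter.1 hx).1
      obtain ⟨z', -, b1', b2'⟩ := hR x' (Finset.mem_filter.1 hx').1
      rw [b1, b1', b2, b2', a3]
    have h4 := card_nbrs_le U
    have h5 : R.card * (d * (d - 1)) ≤ (2 * d * U.card) * (2 * d) :=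
      (h2.trans_eq h1).trans (h3.trans (Nat.mul_le_mul_right _ h4))
    refine Nat.le_of_mul_le_mul_right (c := d * d) ?_ (Nat.mul_pos (by omega) (by omega))
    calc R.card * (d * d) ≤ R.card * (d * (2 * (d - 1))) := by gcongr; omega
      _ = 2 * (R.card * (d * (d - 1))) := by ring
      _ ≤ 2 * ((2 * d * U.card) * (2 * d)) := by omega
      _ = 8 * U.card * (d * d) := by ring

/-! ### Refining an approximation. -/

/-- Add to `I` the neighbours of those vertices of `K` that are not in the class `o`. -/
def spread (o I K : Set (Fin d → ℤ)) : Set (Fin d → ℤ) :=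
  I ∪ {y | ∃ x ∈ K, x ∉ o ∧ (lattice d).Adj x y}

/-- Add to `I` the vertices of the class `o` outside `A` having at least `t` neighbours
outside `A`. -/
def addBusy (o A : Set (Fin d → ℤ)) (t : ℕ) (I : Set (Fin d → ℤ)) : Set (Fin d → ℤ) :=
  I ∪ {x | x ∉ A ∧ x ∈ o ∧ t ≤ (outDirs A x).card}

/-- Given vertices `p.1` known to be inside and vertices `p.2` known to be outside, take the
additional information `K` into account, put the vertices with at least `t` undetermined neighbours
on the side suggested by their class, and take all immediate consequences. -/
def refinePair (o : Set (Fin d → ℤ)) (t : ℕ) (K : Set (Fin d → ℤ))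
    (p : Set (Fin d → ℤ) × Set (Fin d → ℤ)) : Set (Fin d → ℤ) × Set (Fin d → ℤ) :=
  let A := spread o p.1 K ∪ spread oᶜ p.2 K
  let I := addBusy o A t (spread o p.1 K)
  let O := addBusy oᶜ A t (spread oᶜ p.2 K)
  (spread o I I, spread oᶜ O O)

/-- `p.1` is inside `S` and `p.2` is outside. -/
def Approximates (S : Set (Fin d → ℤ)) (p : Set (Fin d → ℤ) × Set (Fin d → ℤ)) : Prop :=
  p.1 ⊆ S ∧ p.2 ⊆ Sᶜ

/-- The determined vertices of a pair. -/
def known (p : Set (Fin d → ℤ) × Set (Fin d → ℤ)) : Set (Fin d → ℤ) := p.1 ∪ p.2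

/-- A pair without immediate consequences in which each undetermined vertex has less than `t`
undetermined neighbours. -/
structure IsTight (o : Set (Fin d → ℤ)) (t : ℕ) (p : Set (Fin d → ℤ) × Set (Fin d → ℤ)) :
    Prop where
  inner : ClosedOff o p.1
  outer : ClosedOff oᶜ p.2
  degree : ∀ x, x ∉ known p → (outDirs (known p) x).card < t

lemma subset_spread (o I K : Set (Fin d → ℤ)) : I ⊆ spread o I K := Set.subset_union_left

lemma subset_addBusy (o A : Set (Fin d → ℤ)) (t : ℕ) (I : Set (Fin d → ℤ)) :
    I ⊆ addBusy o A t I := Set.subset_union_left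

lemma spread_subset {o S I K : Set (Fin d → ℤ)} (hc : ClosedOff o S) (hI : I ⊆ S)
    (hK : ∀ x ∈ K, x ∉ o → x ∈ S) : spread o I K ⊆ S := by
  rintro y (hy | ⟨x, hx, hxo, hxy⟩)
  · exact hI hy
  · exact hc (hK x hx hxo) hxo hxy

/-- One round suffices: the added vertices are in `o` and force nothing further. -/
lemma closedOff_spread {o I : Set (Fin d → ℤ)} (ho : IsClass o) : ClosedOff o (spread o I I) := by
  rintro x (hx | ⟨z, hz, hzo, hzx⟩) hxo y hxy
  · exact Or.inr ⟨x, hx, hxo, hxy⟩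
  · exact absurd ((ho hzx.symm).2 hzo) hxo

lemma outDirs_anti {A B : Set (Fin d → ℤ)} (h : A ⊆ B) (x : Fin d → ℤ) :
    outDirs B x ⊆ outDirs A x := fun _ hδ => mem_outDirs.2 fun hA => mem_outDirs.1 hδ (h hA)

lemma spread_union_subset_known (o : Set (Fin d → ℤ)) (t : ℕ) (K : Set (Fin d → ℤ))
    (p : Set (Fin d → ℤ) × Set (Fin d → ℤ)) :
    spread o p.1 K ∪ spread oᶜ p.2 K ⊆ known (refinePair o t K p) :=
  Set.union_subset_union ((subset_addBusy _ _ _ _).trans (subset_spread _ _ _))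
    ((subset_addBusy _ _ _ _).trans (subset_spread _ _ _))

lemma known_subset_known_refinePair (o : Set (Fin d → ℤ)) (t : ℕ) (K : Set (Fin d → ℤ))
    (p : Set (Fin d → ℤ) × Set (Fin d → ℤ)) : known p ⊆ known (refinePair o t K p) :=
  (Set.union_subset_union (subset_spread _ _ _) (subset_spread _ _ _)).trans
    (spread_union_subset_known o t K p)

lemma isTight_refinePair {o : Set (Fin d → ℤ)} (ho : IsClass o) (t : ℕ) (K : Set (Fin d → ℤ))
    (p : Set (Fin d → ℤ) × Set (Fin d → ℤ)) : IsTight o t (refinePair o t K p) := by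
  refine ⟨closedOff_spread ho, closedOff_spread ho.compl, fun x hx => ?_⟩
  set A := spread o p.1 K ∪ spread oᶜ p.2 K with hA
  have hAk : A ⊆ known (refinePair o t K p) := spread_union_subset_known o t K p
  refine (Finset.card_le_card (outDirs_anti hAk x)).trans_lt ?_
  by_contra! hge
  refine hx ?_
  have hxA : x ∉ A := fun h => hx (hAk h)
  by_cases hxo : x ∈ o
  · exact Or.inl (subset_spread _ _ _ (Or.inr ⟨hxA, hxo, hge⟩))
  · exact Or.inr (subset_spread _ _ _ (Or.inr ⟨hxA, hxo, hge⟩))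

/-- By `hdeg`, undetermined vertices following the default of their class (in exactly when off `o`)
have few undetermined neighbours once `K` is revealed. A busy vertex must then deviate from it,
which is what `addBusy` assumes. -/
lemma approximates_refinePair {o S : Set (Fin d → ℤ)} (ho : IsClass o) (hc : ClosedOff o S)
    {t : ℕ} {K : Set (Fin d → ℤ)} {p : Set (Fin d → ℤ) × Set (Fin d → ℤ)}
    (hp : Approximates S p) (hK : ∀ x ∈ K, x ∉ o → x ∈ S) (hK' : ∀ x ∈ K, x ∈ o → x ∉ S)
    (hdeg : ∀ v, v ∉ known p → (v ∈ S ↔ v ∉ o) →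
      (outDirs (spread o p.1 K ∪ spread oᶜ p.2 K) v).card < t) :
    Approximates S (refinePair o t K p) := by
  have hc' := hc.compl ho
  have h1 : spread o p.1 K ⊆ S := spread_subset hc hp.1 hK
  have h2 : spread oᶜ p.2 K ⊆ Sᶜ := spread_subset hc' hp.2 fun x hx hxo => hK' x hx (not_not.1 hxo)
  have hA : ∀ v, v ∉ spread o p.1 K ∪ spread oᶜ p.2 K → v ∉ known p := fun v hv hv' =>
    hv (Set.union_subset_union (subset_spread _ _ _) (subset_spread _ _ _) hv')
  constructor
  · have h3 : addBusy o (spread o p.1 K ∪ spread oᶜ p.2 K) t (spread o p.1 K) ⊆ S := by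
      rintro x (hx | ⟨hxA, hxo, hxt⟩)
      · exact h1 hx
      · by_contra hxS
        exact absurd (hdeg x (hA x hxA) (by tauto)) (not_lt.2 hxt)
    exact spread_subset hc h3 fun x hx _ => h3 hx
  · have h3 : addBusy oᶜ (spread o p.1 K ∪ spread oᶜ p.2 K) t (spread oᶜ p.2 K) ⊆ Sᶜ := by
      rintro x (hx | ⟨hxA, hxo, hxt⟩)
      · exact h2 hx
      · intro hxS
        have hxo' : x ∉ o := hxo
        exact absurd (hdeg x (hA x hxA) (by tauto)) (not_lt.2 hxt)
    exact spread_subset hc' h3 fun x hx _ => h3 hx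

/-- Greedy choice of vertices of `S` whose neighbourhoods reveal many vertices. -/
lemma exists_greedy {o S A : Set (Fin d → ℤ)} (ho : IsClass o) (hc : ClosedOff o S)
    {Y : Finset (Fin d → ℤ)} (hY : ∀ y ∈ S, y ∈ o → y ∉ A → y ∈ Y) {t : ℕ} (ht : 1 ≤ t) :
    ∃ K : Finset (Fin d → ℤ), (∀ x ∈ K, x ∈ S ∧ x ∉ o ∧ x ∉ A) ∧ K.card * t ≤ Y.card ∧
      ∀ v ∈ S, v ∉ o → v ∉ A →
        (outDirs (A ∪ {y | ∃ x ∈ K, (lattice d).Adj x y}) v).card < t := by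
  classical
  by_contra! hcon
  -- If the process never stopped, `K` could be enlarged forever, each new vertex capturing at least
  -- `t` new elements of `Y`.
  have H : ∀ m : ℕ, ∃ K : Finset (Fin d → ℤ), K.card = m ∧ (∀ x ∈ K, x ∈ S ∧ x ∉ o ∧ x ∉ A) ∧
      K.card * t ≤ (Y.filter fun y => ∃ x ∈ K, (lattice d).Adj x y).card := by
    intro m
    induction m with
    | zero => exact ⟨∅, by simp⟩
    | succ m ih =>
      obtain ⟨K, hKm, hK, hKt⟩ := ih
      obtain ⟨v, hvS, hvo, hvA, hvt⟩ := hcon K hK (hKt.trans (Finset.card_filter_le _ _))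
      have hvK : v ∉ K := by
        intro hvK
        obtain ⟨δ, hδ⟩ := Finset.card_pos.1 (lt_of_lt_of_le ht hvt)
        exact mem_outDirs.1 hδ (Or.inr ⟨v, hvK, adj_step _ _⟩)
      refine ⟨insert v K, by rw [Finset.card_insert_of_notMem hvK, hKm], ?_, ?_⟩
      · intro x hx
        rcases Finset.mem_insert.1 hx with rfl | hx
        · exact ⟨hvS, hvo, hvA⟩
        · exact hK x hx
      · let New := (outDirs (A ∪ {y | ∃ x ∈ K, (lattice d).Adj x y}) v).image fun δ => v + step δ
        have hNew : New.card = (outDirs (A ∪ {y | ∃ x ∈ K, (lattice d).Adj x y}) v).card :=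
          Finset.card_image_of_injective _ fun a b h => step_injective (add_left_cancel h)
        have hdisj : Disjoint (Y.filter fun y => ∃ x ∈ K, (lattice d).Adj x y) New := by
          rw [Finset.disjoint_right]
          intro y hy hy'
          obtain ⟨δ, hδ, rfl⟩ := Finset.mem_image.1 hy
          exact mem_outDirs.1 hδ (Or.inr (Finset.mem_filter.1 hy').2)
        rw [Finset.card_insert_of_notMem hvK, add_mul, one_mul]
        refine (add_le_add hKt (hvt.trans_eq hNew.symm)).trans ?_
        rw [← Finset.card_union_of_disjoint hdisj]
        refine Finset.card_le_card fun y hy => ?_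
        rcases Finset.mem_union.1 hy with hy | hy
        · obtain ⟨hyY, x, hx, hxy⟩ := Finset.mem_filter.1 hy
          exact Finset.mem_filter.2 ⟨hyY, x, Finset.mem_insert_of_mem hx, hxy⟩
        · obtain ⟨δ, hδ, rfl⟩ := Finset.mem_image.1 hy
          refine Finset.mem_filter.2 ⟨hY _ (hc hvS hvo (adj_step _ _)) ?_ ?_, v,
            Finset.mem_insert_self _ _, adj_step _ _⟩
          · by_contra hno
            exact hvo ((ho (adj_step v δ)).2 hno)
          · exact fun h => mem_outDirs.1 hδ (Or.inl h)
  obtain ⟨K, hKm, -, hKt⟩ := H (Y.card + 1)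
  have h1 := Finset.card_filter_le Y fun y => ∃ x ∈ K, (lattice d).Adj x y
  have h2 : K.card ≤ K.card * t := Nat.le_mul_of_pos_right _ ht
  omega

/-- A pair approximating `S` can be refined using little additional information. -/
lemma exists_refinement {o S : Set (Fin d → ℤ)} (ho : IsClass o) (hc : ClosedOff o S)
    {p : Set (Fin d → ℤ) × Set (Fin d → ℤ)} (hp : Approximates S p) {t : ℕ} (ht : 1 ≤ t)
    {Y Y' : Finset (Fin d → ℤ)} (hY : ∀ y ∈ S, y ∈ o → y ∉ known p → y ∈ Y)
    (hY' : ∀ y, y ∉ S → y ∉ o → y ∉ known p → y ∈ Y') :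
    ∃ K : Finset (Fin d → ℤ), (∀ x ∈ K, x ∉ known p) ∧ K.card * t ≤ Y.card + Y'.card ∧
      Approximates S (refinePair o t (K : Set (Fin d → ℤ)) p) := by
  classical
  obtain ⟨K, hK, hKt, hKd⟩ := exists_greedy ho hc hY ht
  obtain ⟨K', hK', hKt', hKd'⟩ := exists_greedy ho.compl (hc.compl ho) hY' ht
  have hK'o : ∀ x ∈ K', x ∈ o := fun x hx => not_not.1 (hK' x hx).2.1
  refine ⟨K ∪ K', ?_, ?_, ?_⟩
  · intro x hx
    rcases Finset.mem_union.1 hx with hx | hx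
    · exact (hK x hx).2.2
    · exact (hK' x hx).2.2
  · calc (K ∪ K').card * t ≤ (K.card + K'.card) * t :=
        Nat.mul_le_mul_right _ (Finset.card_union_le _ _)
      _ ≤ _ := by rw [add_mul]; exact add_le_add hKt hKt'
  · have hsub : ∀ y, y ∈ known p ∪ {y | ∃ x ∈ K, (lattice d).Adj x y} →
        y ∈ spread o p.1 ((K ∪ K' : Finset _) : Set _) ∪
          spread oᶜ p.2 ((K ∪ K' : Finset _) : Set (Fin d → ℤ)) := by
      rintro y ((hy | hy) | ⟨x, hx, hxy⟩)
      · exact Or.inl (Or.inl hy)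
      · exact Or.inr (Or.inl hy)
      · exact Or.inl (Or.inr ⟨x, by simp [hx], (hK x hx).2.1, hxy⟩)
    have hsub' : ∀ y, y ∈ known p ∪ {y | ∃ x ∈ K', (lattice d).Adj x y} →
        y ∈ spread o p.1 ((K ∪ K' : Finset _) : Set _) ∪
          spread oᶜ p.2 ((K ∪ K' : Finset _) : Set (Fin d → ℤ)) := by
      rintro y ((hy | hy) | ⟨x, hx, hxy⟩)
      · exact Or.inl (Or.inl hy)
      · exact Or.inr (Or.inl hy)
      · exact Or.inr (Or.inr ⟨x, by simp [hx], not_not.2 (hK'o x hx), hxy⟩)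
    refine approximates_refinePair ho hc hp ?_ ?_ ?_
    · intro x hx hxo
      rcases Finset.mem_union.1 (Finset.mem_coe.1 hx) with hx | hx
      · exact (hK x hx).1
      · exact absurd (hK'o x hx) hxo
    · intro x hx hxo
      rcases Finset.mem_union.1 (Finset.mem_coe.1 hx) with hx | hx
      · exact absurd hxo (hK x hx).2.1
      · exact (hK' x hx).1
    · intro v hv hvS
      by_cases hvo : v ∈ o
      · exact (Finset.card_le_card (outDirs_anti hsub' v)).trans_lt
          (hKd' v (fun h => (hvS.1 h) hvo) (not_not.2 hvo) hv)
      · exact (Finset.card_le_card (outDirs_anti hsub v)).trans_lt (hKd v (hvS.2 hvo) hvo hv)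

/-- Undetermined vertices of `S` in the class `o` have large boundary degree. -/
lemma IsTight.lt_card_outDirs {o S : Set (Fin d → ℤ)} (ho : IsClass o) {t : ℕ}
    {p : Set (Fin d → ℤ) × Set (Fin d → ℤ)} (hp : Approximates S p) (ht : IsTight o t p)
    {y : Fin d → ℤ} (hyo : y ∈ o) (hy : y ∉ known p) : 2 * d < (outDirs S y).card + t := by
  classical
  have h1 := ht.degree y hy
  rw [← card_dir, ← Finset.card_univ]
  refine lt_of_le_of_lt (b := (outDirs S y).card + (outDirs (known p) y).card) ?_ (by omega)
  refine le_trans (Finset.card_le_card fun δ _ => ?_) (Finset.card_union_le _ _)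
  rw [Finset.mem_union, mem_outDirs, mem_outDirs]
  by_contra! hcon
  rcases hcon.2 with h | h
  · exact hy (Or.inl (ht.inner h ((ho (adj_step y δ)).1 hyo) (adj_step y δ).symm))
  · exact hp.2 h hcon.1

lemma known_swap (p : Set (Fin d → ℤ) × Set (Fin d → ℤ)) : known p.swap = known p :=
  Set.union_comm _ _

lemma IsTight.swap {o : Set (Fin d → ℤ)} {t : ℕ} {p : Set (Fin d → ℤ) × Set (Fin d → ℤ)}
    (ht : IsTight o t p) : IsTight oᶜ t p.swap :=
  ⟨ht.outer, by rw [compl_compl]; exact ht.inner, by rw [known_swap]; exact ht.degree⟩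

lemma Approximates.swap {S : Set (Fin d → ℤ)} {p : Set (Fin d → ℤ) × Set (Fin d → ℤ)}
    (hp : Approximates S p) : Approximates Sᶜ p.swap :=
  ⟨hp.2, by rw [compl_compl]; exact hp.1⟩

/-! ### Counting the sets compatible with a tight pair. -/

/-- The minimal vertex covers of the subgraph induced on `X` that have at most `m` elements and
contain `K`. -/
def minimalCovers {V : Type*} (G : SimpleGraph V) (X : Set V) (m : ℕ) (K : Finset V) :
    Set (Finset V) :=
  {C | (∀ x ∈ X, ∀ y ∈ X, G.Adj x y → x ∈ C ∨ y ∈ C) ∧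
    (∀ x ∈ C, x ∈ X ∧ ∃ y ∈ X, G.Adj x y ∧ y ∉ C) ∧ C.card ≤ m ∧ K ⊆ C}

/-- There are at most `2 ^ m` minimal vertex covers with at most `m` elements. -/
lemma minimalCovers_finite_and_ncard_le {V : Type*} (G : SimpleGraph V) (X : Set V) {m j : ℕ}
    {K : Finset V} (hK : K.card + j = m) :
    (minimalCovers G X m K).Finite ∧ (minimalCovers G X m K).ncard ≤ 2 ^ j := by
  classical
  induction j generalizing K with
  | zero =>
    have h : minimalCovers G X m K ⊆ {K} := by
      rintro C ⟨-, -, h3, h4⟩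
      exact (Finset.eq_of_subset_of_card_le h4 (by omega)).symm
    refine ⟨(Set.finite_singleton K).subset h, ?_⟩
    simpa using Set.ncard_le_ncard h
  | succ j ih =>
    by_cases hcov : ∀ x ∈ X, ∀ y ∈ X, G.Adj x y → x ∈ K ∨ y ∈ K
    · have h : minimalCovers G X m K ⊆ {K} := by
        rintro C ⟨-, h2, -, h4⟩
        refine (Finset.Subset.antisymm h4 fun x hx => ?_).symm
        obtain ⟨hxX, y, hyX, hxy, hyC⟩ := h2 x hx
        exact (hcov x hxX y hyX hxy).resolve_right fun hy => hyC (h4 hy)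
      refine ⟨(Set.finite_singleton K).subset h, ?_⟩
      exact (Set.ncard_le_ncard h).trans (by simpa using Nat.one_le_two_pow)
    · push Not at hcov
      -- Branching: an uncovered edge forces one of its endpoints into the cover, and each branch
      -- uses up one unit of the budget `j`.
      obtain ⟨x, hx, y, hy, hxy, hxK, hyK⟩ := hcov
      have h : minimalCovers G X m K ⊆
          minimalCovers G X m (insert x K) ∪ minimalCovers G X m (insert y K) := by
        rintro C ⟨h1, h2, h3, h4⟩
        rcases h1 x hx y hy hxy with hC | hC
        · exact Or.inl ⟨h1, h2, h3, Finset.insert_subset hC h4⟩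
        · exact Or.inr ⟨h1, h2, h3, Finset.insert_subset hC h4⟩
      obtain ⟨f1, c1⟩ := ih (K := insert x K)
        (by rw [Finset.card_insert_of_notMem hxK]; omega)
      obtain ⟨f2, c2⟩ := ih (K := insert y K)
        (by rw [Finset.card_insert_of_notMem hyK]; omega)
      refine ⟨(f1.union f2).subset h, ?_⟩
      have h5 := Set.ncard_le_ncard h (f1.union f2)
      have h6 := Set.ncard_union_le (minimalCovers G X m (insert x K))
        (minimalCovers G X m (insert y K))
      rw [pow_succ]
      omega

lemma card_mul_le_card_of_dirs {A : Finset (Fin d → ℤ)}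
    {E : Finset ((Fin d → ℤ) × (Fin d → ℤ))} {D : (Fin d → ℤ) → Finset (Dir d)} {k : ℕ}
    (hk : ∀ a ∈ A, k ≤ (D a).card) (hE : ∀ a ∈ A, ∀ δ ∈ D a, (a, a + step δ) ∈ E) :
    A.card * k ≤ E.card := by
  classical
  have h1 : A.card * k ≤ (A.sigma D).card := by
    rw [Finset.card_sigma, ← smul_eq_mul]
    exact Finset.card_nsmul_le_sum _ _ _ hk
  refine h1.trans (Finset.card_le_card_of_injOn (fun p => (p.1, p.1 + step p.2)) ?_ ?_)
  · rintro ⟨a, δ⟩ h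
    have h := Finset.mem_sigma.1 h
    exact hE a h.1 δ h.2
  · rintro ⟨a, δ⟩ - ⟨b, ε⟩ - h
    obtain ⟨rfl, h2⟩ := Prod.mk.injEq .. ▸ h
    obtain rfl := step_injective (add_left_cancel h2)
    rfl

/-- The regular sets `S` closed off `o`, with `n` boundary edges and approximated by `p`. -/
def approximatedSets (o : Set (Fin d → ℤ)) (n : ℕ) (p : Set (Fin d → ℤ) × Set (Fin d → ℤ)) :
    Set (Set (Fin d → ℤ)) :=
  {S | ClosedOff o S ∧ Regular (lattice d) S ∧ S.Finite ∧ (edgePairs S).ncard = n ∧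
    Approximates S p}

/-- The undetermined vertices that violate the default of their class. -/
def deviation (o : Set (Fin d → ℤ)) (p : Set (Fin d → ℤ) × Set (Fin d → ℤ))
    (S : Set (Fin d → ℤ)) : Set (Fin d → ℤ) :=
  {x | x ∉ known p ∧ (x ∈ S ↔ x ∈ o)}

/-- A neighbour in `p.1` would be off the class and, `p.1` being closed off, would already have
determined `x`. -/
lemma IsTight.add_step_mem {o : Set (Fin d → ℤ)} (ho : IsClass o) {t : ℕ}
    {p : Set (Fin d → ℤ) × Set (Fin d → ℤ)} (ht : IsTight o t p) {x y : Fin d → ℤ}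
    (hx : x ∉ known p) (hxo : x ∈ o) (hxy : (lattice d).Adj x y) (hy : y ∈ known p) :
    y ∈ p.2 := by
  rcases hy with h | h
  · exact absurd (Or.inl (ht.inner h ((ho hxy).1 hxo) hxy.symm)) hx
  · exact h

/-- All determined neighbours of a deviating vertex lie on the other side of `S`, and tightness
gives at least `2 * d + 1 - t` of them. The resulting boundary edges are distinct: the inner
endpoint is undetermined for deviating vertices in `o` and determined for the others. -/
lemma deviation_finite_and_ncard_mul_le {o : Set (Fin d → ℤ)} (ho : IsClass o) {t n : ℕ}
    (htd : t ≤ 2 * d) {p : Set (Fin d → ℤ) × Set (Fin d → ℤ)} (ht : IsTight o t p)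
    {S : Set (Fin d → ℤ)} (hS : S ∈ approximatedSets o n p) :
    (deviation o p S).Finite ∧ (deviation o p S).ncard * (2 * d + 1 - t) ≤ n := by
  classical
  obtain ⟨hc, hreg, hfin, hn, hp⟩ := hS
  have hE := edgePairs_finite hfin
  have hswap := hp.swap
  have hts := ht.swap
  have hdeg : ∀ x, x ∉ known p → 2 * d + 1 - t ≤ (outDirs (known p)ᶜ x).card := by
    intro x hx
    have h1 := card_outDirs_add (known p) x
    have h2 := ht.degree x hx
    omega
  have hin : ∀ x ∈ deviation o p S, x ∈ o → ∀ δ ∈ outDirs (known p)ᶜ x,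
      (x, x + step δ) ∈ edgePairs S ∧ x + step δ ∈ known p := by
    intro x hx hxo δ hδ
    have h1 : x + step δ ∈ known p := not_not.1 (mem_outDirs.1 hδ)
    exact ⟨⟨hx.2.2 hxo, hp.2 (ht.add_step_mem ho hx.1 hxo (adj_step _ _) h1), adj_step _ _⟩, h1⟩
  have hout : ∀ x ∈ deviation o p S, x ∉ o → ∀ δ ∈ outDirs (known p)ᶜ x,
      (x + step δ, x) ∈ edgePairs S ∧ x + step δ ∈ known p := by
    intro x hx hxo δ hδ
    have h1 : x + step δ ∈ known p := not_not.1 (mem_outDirs.1 hδ)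
    have h2 : x + step δ ∈ p.1 := by
      have := hts.add_step_mem ho.compl (x := x) (y := x + step δ)
        (by rw [known_swap]; exact hx.1) hxo (adj_step _ _) (by rw [known_swap]; exact h1)
      exact this
    exact ⟨⟨hp.1 h2, fun h => hxo (hx.2.1 h), (adj_step _ _).symm⟩, h1⟩
  have hdevfin : (deviation o p S).Finite := by
    refine ((hE.image Prod.fst).union (hE.image Prod.snd)).subset fun x hx => ?_
    obtain ⟨δ, hδ⟩ : (outDirs (known p)ᶜ x).Nonempty :=
      Finset.card_pos.1 (lt_of_lt_of_le (by omega) (hdeg x hx.1))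
    by_cases hxo : x ∈ o
    · exact Or.inl ⟨_, (hin x hx hxo δ hδ).1, rfl⟩
    · exact Or.inr ⟨_, (hout x hx hxo δ hδ).1, rfl⟩
  refine ⟨hdevfin, ?_⟩
  let C := hdevfin.toFinset
  have hC : ∀ x, x ∈ C ↔ x ∈ deviation o p S := fun x => Set.Finite.mem_toFinset _
  let E₁ := hE.toFinset.filter fun e => e.1 ∉ known p ∧ e.2 ∈ known p
  let E₂ := hE.toFinset.filter fun e => e.1 ∈ known p
  have h1 : (C.filter (· ∈ o)).card * (2 * d + 1 - t) ≤ E₁.card := by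
    refine card_mul_le_card_of_dirs (D := outDirs (known p)ᶜ) ?_ ?_
    · intro a ha
      exact hdeg a ((hC a).1 (Finset.mem_filter.1 ha).1).1
    · intro a ha δ hδ
      obtain ⟨ha, hao⟩ := Finset.mem_filter.1 ha
      have := hin a ((hC a).1 ha) hao δ hδ
      exact Finset.mem_filter.2 ⟨by simpa using this.1, ((hC a).1 ha).1, this.2⟩
  have h2 : (C.filter (· ∉ o)).card * (2 * d + 1 - t) ≤ (E₂.image Prod.swap).card := by
    refine card_mul_le_card_of_dirs (D := outDirs (known p)ᶜ) ?_ ?_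
    · intro a ha
      exact hdeg a ((hC a).1 (Finset.mem_filter.1 ha).1).1
    · intro a ha δ hδ
      obtain ⟨ha, hao⟩ := Finset.mem_filter.1 ha
      have := hout a ((hC a).1 ha) hao δ hδ
      exact Finset.mem_image.2 ⟨_, Finset.mem_filter.2 ⟨by simpa using this.1, this.2⟩, rfl⟩
  have h3 : E₁.card + E₂.card ≤ n := by
    rw [← hn, Set.ncard_eq_toFinset_card _ hE, ← Finset.card_union_of_disjoint]
    · exact Finset.card_le_card
        (Finset.union_subset (Finset.filter_subset _ _) (Finset.filter_subset _ _))
    · rw [Finset.disjoint_left]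
      intro e he he'
      exact (Finset.mem_filter.1 he).2.1 (Finset.mem_filter.1 he').2
  have h4 : (E₂.image Prod.swap).card ≤ E₂.card := Finset.card_image_le
  rw [Set.ncard_eq_toFinset_card _ hdevfin,
    ← Finset.card_filter_add_card_filter_not (s := hdevfin.toFinset) (· ∈ o), add_mul]
  exact (add_le_add h1 (h2.trans h4)).trans h3

lemma approximatedSets_eq_of_deviation_eq {o : Set (Fin d → ℤ)} {n : ℕ}
    {p : Set (Fin d → ℤ) × Set (Fin d → ℤ)} {S S' : Set (Fin d → ℤ)}
    (hS : S ∈ approximatedSets o n p) (hS' : S' ∈ approximatedSets o n p)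
    (h : deviation o p S = deviation o p S') : S = S' := by
  obtain ⟨-, -, -, -, hp⟩ := hS
  obtain ⟨-, -, -, -, hp'⟩ := hS'
  ext x
  by_cases hx : x ∈ known p
  · rcases hx with hx | hx
    · exact iff_of_true (hp.1 hx) (hp'.1 hx)
    · exact iff_of_false (hp.2 hx) (hp'.2 hx)
  · have h1 : x ∈ deviation o p S ↔ x ∈ deviation o p S' := by rw [h]
    simp only [deviation, Set.mem_ofPred_eq] at h1
    tauto

/-- A tight pair approximates few sets. -/
lemma approximatedSets_finite_and_ncard_le {o : Set (Fin d → ℤ)} (ho : IsClass o) {t n : ℕ}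
    (htd : t ≤ 2 * d) {p : Set (Fin d → ℤ) × Set (Fin d → ℤ)} (ht : IsTight o t p) :
    (approximatedSets o n p).Finite ∧
      (approximatedSets o n p).ncard ≤ 2 ^ (n / (2 * d + 1 - t)) := by
  classical
  set m := n / (2 * d + 1 - t) with hm
  obtain ⟨f1, c1⟩ := minimalCovers_finite_and_ncard_le (lattice d) (known p)ᶜ (m := m) (j := m)
    (K := ∅) (by simp)
  let F : Set (Fin d → ℤ) → Finset (Fin d → ℤ) := fun S =>
    if h : (deviation o p S).Finite then h.toFinset else ∅
  have hF : ∀ S ∈ approximatedSets o n p, (F S : Set (Fin d → ℤ)) = deviation o p S := by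
    intro S hS
    simp [F, (deviation_finite_and_ncard_mul_le ho htd ht hS).1]
  have hF' : ∀ S ∈ approximatedSets o n p, ∀ x, x ∈ F S ↔ x ∈ deviation o p S := by
    intro S hS x
    rw [← hF S hS, Finset.mem_coe]
  have hinj : Set.InjOn F (approximatedSets o n p) := by
    intro S hS S' hS' h
    refine approximatedSets_eq_of_deviation_eq hS hS' ?_
    rw [← hF S hS, ← hF S' hS', h]
  -- Covering: an edge without deviation would join a vertex of `S` off `o` to a vertex outside `S`.
  -- Minimality: by regularity a deviating vertex has a neighbour on its own side, which is
  -- undetermined and follows the default.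
  have hmaps : Set.MapsTo F (approximatedSets o n p) (minimalCovers (lattice d) (known p)ᶜ m ∅) := by
    intro S hS
    have hcard := (deviation_finite_and_ncard_mul_le ho htd ht hS).2
    have hFS := hF' S hS
    have hFS' := hF S hS
    obtain ⟨hc, hreg, hfin, hn, hp⟩ := hS
    refine ⟨?_, ?_, ?_, Finset.empty_subset _⟩
    · intro x hx y hy hxy
      rw [hFS, hFS]
      have h1 := ho hxy
      by_cases hxS : x ∈ S <;> by_cases hyS : y ∈ S <;> by_cases hxo : x ∈ o
      · exact Or.inl ⟨hx, by tauto⟩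
      · exact Or.inr ⟨hy, by tauto⟩
      · exact Or.inl ⟨hx, by tauto⟩
      · exact absurd (hc hxS hxo hxy) hyS
      · exact absurd (hc hyS (h1.1 hxo) hxy.symm) hxS
      · exact Or.inr ⟨hy, by tauto⟩
      · exact Or.inr ⟨hy, by tauto⟩
      · exact Or.inl ⟨hx, by tauto⟩
    · intro x hx
      rw [hFS] at hx
      refine ⟨hx.1, ?_⟩
      by_cases hxo : x ∈ o
      · obtain ⟨y, hy, hxy⟩ := hreg.1 x (hx.2.2 hxo)
        refine ⟨y, fun hyk => ?_, hxy, fun hyF => ?_⟩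
        · exact hp.2 (ht.add_step_mem ho hx.1 hxo hxy hyk) hy
        · exact (ho hxy).1 hxo (((hFS y).1 hyF).2.1 hy)
      · obtain ⟨y, hy, hxy⟩ := hreg.2 x fun h => hxo (hx.2.1 h)
        refine ⟨y, fun hyk => ?_, hxy, fun hyF => ?_⟩
        · have := ht.swap.add_step_mem ho.compl (x := x) (y := y)
            (by rw [known_swap]; exact hx.1) hxo hxy (by rw [known_swap]; exact hyk)
          exact hy (hp.1 this)
        · exact hy (((hFS y).1 hyF).2.2 ((ho hxy.symm).2 hxo))
    · rw [hm, Nat.le_div_iff_mul_le (by omega), ← Set.ncard_coe_finset, hFS']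
      exact hcard
  exact ⟨Set.Finite.of_injOn hmaps hinj f1,
    (Set.ncard_le_ncard_of_injOn F hmaps hinj f1).trans c1⟩

/-! ### Encoding labelled sets by words. -/

/-- Reading a word of displacements and labels from `a`, collect the positions carrying each
label. -/
def decode {R m : ℕ} : (Fin d → ℤ) → List ((Fin R → Option (Dir d)) × (Fin m → Bool)) →
    Fin m → Set (Fin d → ℤ)
  | _, [], _ => ∅
  | a, (g, b) :: l, i => {x | x = a + ∑ j, idleStep (g j) ∧ b i = true} ∪
      decode (a + ∑ j, idleStep (g j)) l i

lemma exists_encode {R m : ℕ} (A : Fin m → Set (Fin d → ℤ)) (l : List (Fin d → ℤ))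
    (a : Fin d → ℤ) (hl : (a :: l).IsChain fun x y => l1 (x - y) ≤ R) :
    ∃ w : List ((Fin R → Option (Dir d)) × (Fin m → Bool)), w.length = l.length ∧
      ∀ i, decode a w i = {x | x ∈ l ∧ x ∈ A i} := by
  classical
  induction l generalizing a with
  | nil => exact ⟨[], rfl, fun i => by simp [decode]⟩
  | cons b l ih =>
    rw [List.isChain_cons_cons] at hl
    obtain ⟨w, hw, hdec⟩ := ih b hl.2
    rw [l1_sub_comm] at hl
    obtain ⟨g, hg⟩ := exists_sum_idleStep hl.1
    have hb : a + ∑ j, idleStep (g j) = b := by rw [← hg]; abel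
    refine ⟨(g, fun i => decide (b ∈ A i)) :: w, by simp [hw], fun i => ?_⟩
    ext x
    simp only [decode, hb, hdec, Set.mem_union, Set.mem_ofPred_eq, decide_eq_true_eq,
      List.mem_cons]
    constructor
    · rintro (⟨rfl, h⟩ | ⟨h, h'⟩)
      · exact ⟨Or.inl rfl, h⟩
      · exact ⟨Or.inr h, h'⟩
    · rintro ⟨rfl | h, h'⟩
      · exact Or.inl ⟨rfl, h'⟩
      · exact Or.inr ⟨h, h'⟩

/-- Idle letters without labels serve as padding, so that all words can have the same length. -/
lemma decode_replicate_append {R m : ℕ} (a : Fin d → ℤ) (k : ℕ)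
    (w : List ((Fin R → Option (Dir d)) × (Fin m → Bool))) :
    decode a (List.replicate k (fun _ => none, fun _ => false) ++ w) = decode a w := by
  induction k with
  | zero => rfl
  | succ k ih =>
    rw [List.replicate_succ, List.cons_append]
    funext i
    simp [decode, idleStep, ih]

/-- A finite set that cannot be split into two distant parts is visited by a short walk. -/
lemma exists_exhausting_chain {R : ℕ} {T : Finset (Fin d → ℤ)} {a : Fin d → ℤ} (ha : a ∈ T)
    (hT : ∀ X ⊆ T, a ∈ X → X ≠ T → ∃ x ∈ X, ∃ y ∈ T, y ∉ X ∧ l1 (x - y) ≤ R) :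
    ∃ l : List (Fin d → ℤ), (a :: l).IsChain (fun x y => l1 (x - y) ≤ R) ∧
      (∀ x ∈ T, x ∈ a :: l) ∧ l.length + 2 = 2 * T.card := by
  classical
  have H : ∀ j, j + 1 ≤ T.card → ∃ X ⊆ T, a ∈ X ∧ X.card = j + 1 ∧ ∃ l : List (Fin d → ℤ),
      (a :: l).IsChain (fun x y => l1 (x - y) ≤ R) ∧ (∀ x ∈ X, x ∈ a :: l) ∧
        l.length = 2 * j := by
    intro j
    induction j with
    | zero =>
      intro _
      exact ⟨{a}, by simpa using ha, by simp, by simp, [], by simp, by simp, rfl⟩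
    | succ j ih =>
      intro hj
      obtain ⟨X, hXT, haX, hXc, l, hl, hXl, hlen⟩ := ih (by omega)
      obtain ⟨x, hx, y, hyT, hyX, hxy⟩ := hT X hXT haX (by rintro rfl; omega)
      obtain ⟨l₁, l₂, hsplit⟩ := List.append_of_mem (hXl x hx)
      -- The walk is extended by the detour `x, y, x` at an occurrence of `x`: two further entries
      -- for each new vertex.
      obtain ⟨l', hl'⟩ : ∃ l', l₁ ++ x :: y :: x :: l₂ = a :: l' := by
        cases l₁ with
        | nil =>
          rw [List.nil_append, List.cons.injEq] at hsplit
          exact ⟨y :: x :: l₂, by rw [hsplit.1]; rfl⟩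
        | cons b l₁ =>
          rw [List.cons_append, List.cons.injEq] at hsplit
          exact ⟨l₁ ++ x :: y :: x :: l₂, by rw [hsplit.1]; rfl⟩
      refine ⟨insert y X, Finset.insert_subset hyT hXT, Finset.mem_insert_of_mem haX,
        by rw [Finset.card_insert_of_notMem hyX, hXc], l', ?_, ?_, ?_⟩
      · rw [← hl']
        rw [hsplit, List.isChain_split] at hl
        rw [List.isChain_split, List.isChain_cons_cons, List.isChain_cons_cons]
        exact ⟨hl.1, hxy, by rwa [l1_sub_comm], hl.2⟩
      · intro z hz
        rw [← hl']
        rcases Finset.mem_insert.1 hz with rfl | hz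
        · simp
        · have := hXl z hz
          rw [hsplit] at this
          simp only [List.mem_append, List.mem_cons] at this ⊢
          tauto
      · have h1 := congrArg List.length hl'
        have h2 := congrArg List.length hsplit
        simp only [List.length_append, List.length_cons] at h1 h2
        omega
  have hpos : 0 < T.card := Finset.card_pos.2 ⟨a, ha⟩
  obtain ⟨X, hXT, -, hXc, l, hl, hXl, hlen⟩ := H (T.card - 1) (by omega)
  obtain rfl : X = T := Finset.eq_of_subset_of_card_le hXT (by omega)
  exact ⟨l, hl, hXl, by omega⟩

lemma exists_word {R m N : ℕ} {T : Finset (Fin d → ℤ)} {a : Fin d → ℤ} (ha : a ∈ T)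
    (hT : ∀ X ⊆ T, a ∈ X → X ≠ T → ∃ x ∈ X, ∃ y ∈ T, y ∉ X ∧ l1 (x - y) ≤ R)
    (A : Fin m → Set (Fin d → ℤ)) (hA : ∀ i, A i ⊆ T) (hN : 2 * T.card ≤ N) :
    ∃ w : Fin N → (Fin R → Option (Dir d)) × (Fin m → Bool), decode a (List.ofFn w) = A := by
  obtain ⟨l, hl, hTl, hlen⟩ := exists_exhausting_chain ha hT
  -- The start `a` is repeated so that a first letter of zero displacement can carry its labels.
  obtain ⟨w, hw, hdec⟩ := exists_encode A (a :: l) a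
    (by rw [List.isChain_cons_cons]; exact ⟨by simp [l1_zero], hl⟩)
  rw [List.length_cons] at hw
  obtain ⟨k, rfl⟩ : ∃ k, N = k + w.length := ⟨N - w.length, by omega⟩
  have hlen' : (List.replicate k ((fun _ => none : Fin R → Option (Dir d)),
      (fun _ => false : Fin m → Bool)) ++ w).length = k + w.length := by simp
  refine ⟨fun i => (List.replicate k (fun _ => none, fun _ => false) ++ w).get
    (i.cast hlen'.symm), ?_⟩
  have h : List.ofFn (fun i : Fin (k + w.length) =>
      (List.replicate k ((fun _ => none : Fin R → Option (Dir d)),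
        (fun _ => false : Fin m → Bool)) ++ w).get (i.cast hlen'.symm)) =
      List.replicate k (fun _ => none, fun _ => false) ++ w := by
    refine List.ext_get (by simp) fun i h1 h2 => ?_
    simp
  rw [h, decode_replicate_append]
  funext i
  rw [hdec]
  ext x
  exact ⟨fun h => h.2, fun h => ⟨hTl x (hA i h), h⟩⟩

/-- A set of vertices near the boundary of an `r`-cutset that comes close to each boundary edge
cannot be split into two distant parts. -/
lemma exists_near_of_ne {S : Set (Fin d → ℤ)} {r : ℕ} (hS : ConnectedIn (power (lattice d) r) S)
    (hS' : ConnectedIn (power (lattice d) r) Sᶜ) {T : Finset (Fin d → ℤ)}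
    (hcov : ∀ b ∈ internalBoundary (lattice d) S, ∃ w ∈ T, l1 (b - w) ≤ 2)
    (hT : ∀ t ∈ T, ∃ b ∈ internalBoundary (lattice d) S, l1 (t - b) ≤ r + 4)
    {X : Finset (Fin d → ℤ)} (hX : X ⊆ T) (hne : X.Nonempty) (hXT : X ≠ T) :
    ∃ x ∈ X, ∃ y ∈ T, y ∉ X ∧ l1 (x - y) ≤ 2 * r + 8 := by
  by_contra! hfar
  -- If `X` were at distance more than `2r + 8 = 2 + (2r + 4) + 2` from the rest of `T`, being near
  -- `X` would be locally constant on the boundary, hence constant. Both values contradict `hT`.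
  have h := internalBoundary_unsplittable (P := fun b => ∃ x ∈ X, l1 (b - x) ≤ 2) hS hS' (by
    have key : ∀ u u', u' ∈ internalBoundary (lattice d) S → l1 (u - u') ≤ 2 * r + 4 →
        (∃ x ∈ X, l1 (u - x) ≤ 2) → ∃ x ∈ X, l1 (u' - x) ≤ 2 := by
      rintro u u' hu' huu' ⟨x, hx, hux⟩
      obtain ⟨w, hw, huw⟩ := hcov u' hu'
      refine ⟨w, ?_, huw⟩
      by_contra hwX
      have h1 := hfar x hx w hw hwX
      have h2 := l1_sub_le x u w
      have h3 := l1_sub_le u u' w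
      rw [l1_sub_comm x u] at h2
      omega
    intro u hu u' hu' huu'
    exact ⟨key u u' hu' huu', key u' u hu (by rwa [l1_sub_comm])⟩)
  rcases h with h | h
  · obtain ⟨y, hyT, hyX⟩ : ∃ y ∈ T, y ∉ X := by
      by_contra! hcon
      exact hXT (Finset.Subset.antisymm hX hcon)
    obtain ⟨b, hb, hyb⟩ := hT y hyT
    obtain ⟨x, hx, hbx⟩ := h b hb
    have h1 := hfar x hx y hyT hyX
    have h2 := l1_sub_le x b y
    rw [l1_sub_comm x b, l1_sub_comm b y] at h2
    omega
  · obtain ⟨x, hx⟩ := hne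
    obtain ⟨b, hb, hxb⟩ := hT x (hX hx)
    obtain ⟨w, hw, hbw⟩ := hcov b hb
    have hwX : w ∉ X := fun hwX => h b hb ⟨w, hwX, hbw⟩
    have h1 := hfar x hx w hw hwX
    have h2 := l1_sub_le x b w
    omega

/-! ### From cutsets to words and the raw counting bound. -/

/-- The pair of determined sets obtained from a separating set (label `0`), representatives of
components (label `1`), and the information for two rounds of refinement (labels `2` and `3`). -/
def pairOf (o : Set (Fin d → ℤ)) (t : ℕ) (A : Fin 4 → Set (Fin d → ℤ)) :
    Set (Fin d → ℤ) × Set (Fin d → ℤ) :=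
  refinePair o t (A 3) (refinePair o d (A 2)
    (linkedTo {x | ∃ w ∈ A 0, (lattice d).Adj w x} (A 1),
      largeNotLinkedTo {x | ∃ w ∈ A 0, (lattice d).Adj w x} (A 1)))

/-- The sets in a small finite set near the boundary determine a good approximation. -/
lemma exists_labels {o S : Set (Fin d → ℤ)} (ho : IsClass o) (hc : ClosedOff o S)
    (hreg : Regular (lattice d) S) (hfin : S.Finite) (hne : S.Nonempty) (hd : 2 ≤ d) {t : ℕ}
    (ht : 1 ≤ t) :
    ∃ U K₁ R K₂ : Finset (Fin d → ℤ),
      (∀ p ∈ edgePairs S, ∃ w ∈ U, l1 (p.1 - w) ≤ 2) ∧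
      (∀ w ∈ U, ∃ p ∈ edgePairs S, l1 (w - p.1) ≤ 2) ∧
      (∀ x ∈ R ∪ K₁ ∪ K₂, ∃ u ∈ U, l1 (x - u) ≤ 2) ∧
      (U.card : ℝ) ≤ 16 * ((edgePairs S).ncard * scale d / d ^ 2) ∧
      R.card ≤ 8 * U.card ∧ K₁.card ≤ 12 * U.card ∧
      K₂.card * (t * d) ≤ 2 * (edgePairs S).ncard ∧
      Approximates S (pairOf o t ![U, R, K₁, K₂]) := by
  classical
  have hE := edgePairs_finite hfin
  have hE' : (edgePairs Sᶜ).Finite := by rw [edgePairs_compl]; exact hE.image _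
  have hn := sq_le_ncard_edgePairs ho hc hreg hfin hne hd
  obtain ⟨U, hU1, hU2, hUc⟩ := exists_separating ho hc hreg hE hd hn
  have hsep : ∀ p ∈ edgePairs S, p.1 ∈ nbrs U ∨ p.2 ∈ nbrs U := by
    intro p hp
    obtain ⟨w, hw, h | h⟩ := hU1 p hp
    · exact Or.inl (mem_nbrs.2 ⟨w, hw, h⟩)
    · exact Or.inr (mem_nbrs.2 ⟨w, hw, h⟩)
  obtain ⟨R, hR1, hR2, hR3, hRc⟩ := exists_representatives hfin hd hsep
  obtain ⟨X, hX1, hX2, hXc⟩ := exists_finset_undetermined U (R : Set (Fin d → ℤ)) hd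
  have hW : (nbrs U : Set (Fin d → ℤ)) =
      {x | ∃ w ∈ (U : Set (Fin d → ℤ)), (lattice d).Adj w x} := by
    ext x
    simp [mem_nbrs]
  rw [hW] at hR1 hR2 hX1
  set p₀ := (linkedTo {x | ∃ w ∈ (U : Set (Fin d → ℤ)), (lattice d).Adj w x} (R : Set _),
      largeNotLinkedTo {x | ∃ w ∈ (U : Set (Fin d → ℤ)), (lattice d).Adj w x} (R : Set _)) with hp₀
  have hX1' : ∀ x, x ∉ known p₀ → x ∈ X := hX1
  obtain ⟨K₁, hK₁, hK₁c, hap₁⟩ := exists_refinement ho hc (p := p₀) ⟨hR1, hR2⟩ (t := d) (by omega)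
    (Y := X) (Y' := X) (fun y _ _ hy => hX1' y hy) (fun y _ _ hy => hX1' y hy)
  set p₁ := refinePair o d (K₁ : Set (Fin d → ℤ)) p₀ with hp₁
  have ht₁ : IsTight o d p₁ := isTight_refinePair ho _ _ _
  have hX2' : ∀ x, x ∉ known p₁ → x ∈ X := fun x hx =>
    hX1' x fun h => hx (known_subset_known_refinePair o d _ p₀ h)
  let Y := X.filter fun y => y ∈ S ∧ y ∈ o ∧ y ∉ known p₁
  let Y' := X.filter fun y => y ∉ S ∧ y ∉ o ∧ y ∉ known p₁
  -- This is the gain of the first round: remaining vertices of `S` in `o` each have more than `d`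
  -- boundary edges, so there are at most `n / d` of them and the finer threshold `t` becomes
  -- affordable.
  have hY : Y.card * d ≤ (edgePairs S).ncard := by
    refine card_mul_le_ncard_edgePairs hE (fun a ha => (Finset.mem_filter.1 ha).2.1) ?_
    intro a ha
    have := ht₁.lt_card_outDirs ho hap₁ (Finset.mem_filter.1 ha).2.2.1
      (Finset.mem_filter.1 ha).2.2.2
    omega
  have hY' : Y'.card * d ≤ (edgePairs S).ncard := by
    rw [← ncard_edgePairs_compl]
    refine card_mul_le_ncard_edgePairs hE' (fun a ha => (Finset.mem_filter.1 ha).2.1) ?_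
    intro a ha
    have := ht₁.swap.lt_card_outDirs ho.compl hap₁.swap (Finset.mem_filter.1 ha).2.2.1
      (by rw [known_swap]; exact (Finset.mem_filter.1 ha).2.2.2)
    omega
  obtain ⟨K₂, hK₂, hK₂c, hap₂⟩ := exists_refinement ho hc hap₁ ht
    (Y := Y) (Y' := Y') (fun y h1 h2 h3 => Finset.mem_filter.2 ⟨hX2' y h3, h1, h2, h3⟩)
    (fun y h1 h2 h3 => Finset.mem_filter.2 ⟨hX2' y h3, h1, h2, h3⟩)
  refine ⟨U, K₁, R, K₂, ?_, hU2, ?_, hUc, hRc, ?_, ?_, hap₂⟩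
  · intro p hp
    obtain ⟨w, hw, h | h⟩ := hU1 p hp
    · exact ⟨w, hw, by rw [l1_of_adj h.symm]; norm_num⟩
    · refine ⟨w, hw, (l1_sub_le _ p.2 _).trans ?_⟩
      rw [l1_of_adj hp.2.2, l1_of_adj h.symm]
  · intro x hx
    simp only [Finset.mem_union] at hx
    rcases hx with (hx | hx) | hx
    · exact hR3 x hx
    · exact hX2 x (hX1' x (hK₁ x hx))
    · exact hX2 x (hX2' x (hK₂ x hx))
  · refine Nat.le_of_mul_le_mul_right (c := d) ?_ (by omega)
    calc K₁.card * d ≤ X.card + X.card := hK₁c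
      _ ≤ 6 * d * U.card + 6 * d * U.card := add_le_add hXc hXc
      _ = _ := by ring
  · calc K₂.card * (t * d) = K₂.card * t * d := by ring
      _ ≤ (Y.card + Y'.card) * d := Nat.mul_le_mul_right _ hK₂c
      _ ≤ _ := by rw [add_mul]; omega

lemma exists_mem_l1_le {S : Set (Fin d → ℤ)} {r : ℕ} (h : setDist (lattice d) {0} S ≤ r) :
    ∃ x ∈ S, l1 x ≤ r := by
  have h1 : setDist (lattice d) {0} S < ((r + 1 : ℕ) : ℕ∞) :=
    lt_of_le_of_lt h (by exact_mod_cast Nat.lt_succ_self r)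
  simp only [setDist, Set.mem_singleton_iff, iInf_iInf_eq_left, iInf_lt_iff] at h1
  obtain ⟨x, hx, hlt⟩ := h1
  obtain ⟨p, hp⟩ := SimpleGraph.exists_walk_of_edist_ne_top (ne_top_of_lt hlt)
  rw [← hp] at hlt
  have h2 : p.length < r + 1 := by exact_mod_cast hlt
  have h3 := l1_le_walk_length p
  rw [zero_sub, l1_neg] at h3
  exact ⟨x, hx, by omega⟩

/-- The words encoding approximations. -/
abbrev Word (d r N : ℕ) : Type :=
  Fin N → (Fin (2 * r + 8) → Option (Dir d)) × (Fin 4 → Bool)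

lemma card_word (d r N : ℕ) :
    Fintype.card (Word d r N) = ((2 * d + 1) ^ (2 * r + 8) * 2 ^ 4) ^ N := by
  simp [Word, mul_comm d 2]

/-- Each odd cutset is approximated by the pair encoded by a short word. -/
lemma exists_word_approximating {n r N : ℕ} (hd : 2 ≤ d) {S : Set (Fin d → ℤ)}
    (hS : S ∈ oddCutsets d n r) (hN : 700 * (n * scale d / d ^ 2) ≤ N) :
    ∃ k < n, ∃ w : Word d r N,
      S ∈ approximatedSets {x | IsOddVertex x} n (pairOf {x | IsOddVertex x} ⌈Real.sqrt d⌉₊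
        (decode ((k : ℤ) • step (⟨0, by omega⟩, true)) (List.ofFn w))) := by
  classical
  obtain ⟨⟨hfin, hreg, hconn, hcoconn⟩, hodd, hn, hdist⟩ := hS
  rw [ncard_edgeBoundary] at hn
  have ho := isClass_odd (d := d)
  have hc := hodd.closedOff
  set o : Set (Fin d → ℤ) := {x | IsOddVertex x}
  have hd1 : (2 : ℝ) ≤ d := by exact_mod_cast hd
  have ht1 : 1 ≤ ⌈Real.sqrt d⌉₊ := Nat.one_le_ceil_iff.2 (by positivity)
  obtain ⟨x, hx, hxr⟩ := exists_mem_l1_le hdist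
  obtain ⟨k, hkn, hk1, hk2⟩ := exists_exit_lt hfin hx (δ := (⟨0, by omega⟩, true))
    (ε := (⟨1, by omega⟩, true)) (by simp)
  set a : Fin d → ℤ := (k : ℤ) • step (⟨0, by omega⟩, true) with ha
  obtain ⟨U, K₁, R, K₂, hU1, hU2, hnear, hUc, hRc, hK₁c, hK₂c, hap⟩ :=
    exists_labels ho hc hreg hfin ⟨x, hx⟩ hd ht1
  let T : Finset (Fin d → ℤ) := insert a (U ∪ (R ∪ K₁ ∪ K₂))
  -- The count is `1 + (1 + 8 + 12) * 16 + 4 = 341` in units of `z`, using `1 ≤ z`.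
  have hTcard : (T.card : ℝ) ≤ 350 * (n * scale d / d ^ 2) := by
    rw [hn] at hUc hK₂c
    set z := n * scale d / d ^ 2 with hz
    have hq := one_le_scale hd
    have hn2 : d ^ 2 ≤ n := hn ▸ sq_le_ncard_edgePairs ho hc hreg hfin ⟨x, hx⟩ hd
    have hn2' : (d : ℝ) ^ 2 ≤ n := by exact_mod_cast hn2
    have hz1 : 1 ≤ z := by
      rw [hz, le_div_iff₀ (by positivity)]
      nlinarith
    have e1 : T.card ≤ 1 + (U.card + (R.card + K₁.card + K₂.card)) := by
      have h1 := Finset.card_insert_le a (U ∪ (R ∪ K₁ ∪ K₂))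
      have h2 := Finset.card_union_le U (R ∪ K₁ ∪ K₂)
      have h3 := Finset.card_union_le (R ∪ K₁) K₂
      have h4 := Finset.card_union_le R K₁
      have h5 : T.card = (insert a (U ∪ (R ∪ K₁ ∪ K₂))).card := rfl
      omega
    have e2 : (T.card : ℝ) ≤ 1 + 21 * U.card + K₂.card := by
      exact_mod_cast (by omega : T.card ≤ 1 + 21 * U.card + K₂.card)
    have e3 : (K₂.card : ℝ) ≤ 4 * z := by
      have h1 : (K₂.card : ℝ) * (Real.sqrt d * d) ≤ 2 * n := by
        calc (K₂.card : ℝ) * (Real.sqrt d * d) ≤ K₂.card * (⌈Real.sqrt d⌉₊ * d) := by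
              gcongr
              exact Nat.le_ceil _
          _ ≤ 2 * n := by exact_mod_cast hK₂c
      have hsq : Real.sqrt d * Real.sqrt d = d := Real.mul_self_sqrt (by linarith)
      have h2 : Real.sqrt d ≤ 2 * scale d := by
        refine Real.sqrt_le_iff.2 ⟨by linarith, ?_⟩
        rw [mul_pow, scale_sq hd]
        have h3 : Real.log 2 ≤ Real.log d := Real.log_le_log (by norm_num) hd1
        have h4 := Real.log_two_gt_d9
        nlinarith
      have h3 : (K₂.card : ℝ) * (d * d) ≤ 4 * (n * scale d) := by
        calc (K₂.card : ℝ) * (d * d) = K₂.card * (Real.sqrt d * d) * Real.sqrt d := by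
              rw [mul_assoc, mul_assoc, mul_comm (d : ℝ) (Real.sqrt d), ← mul_assoc (Real.sqrt _),
                hsq]
          _ ≤ 2 * n * (2 * scale d) := by gcongr
          _ = _ := by ring
      rw [hz, mul_div_assoc', le_div_iff₀ (by positivity), sq]
      exact h3
    linarith
  have hT : ∀ b ∈ T, ∃ b' ∈ internalBoundary (lattice d) S, l1 (b - b') ≤ r + 4 := by
    have hUT : ∀ u ∈ U, ∃ b' ∈ internalBoundary (lattice d) S, l1 (u - b') ≤ 2 := by
      intro u hu
      obtain ⟨p, hp, hup⟩ := hU2 u hu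
      exact ⟨p.1, ⟨hp.1, p.2, hp.2.1, hp.2.2⟩, hup⟩
    intro b hb
    rcases Finset.mem_insert.1 hb with rfl | hb
    -- The start `a` is within `r` of the exit vertex `x + a`, because `x` is within `r` of the
    -- origin.
    · refine ⟨_, ⟨hk1, _, hk2, adj_step _ _⟩, ?_⟩
      have : a - (x + a) = -x := by abel
      rw [this, l1_neg]
      omega
    · rcases Finset.mem_union.1 hb with hb | hb
      · obtain ⟨b', hb', h⟩ := hUT b hb
        exact ⟨b', hb', by omega⟩
      · obtain ⟨u, hu, hbu⟩ := hnear b hb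
        obtain ⟨b', hb', h⟩ := hUT u hu
        have := l1_sub_le b u b'
        exact ⟨b', hb', by omega⟩
  have hcov : ∀ b ∈ internalBoundary (lattice d) S, ∃ w ∈ T, l1 (b - w) ≤ 2 := by
    rintro b ⟨hb, c, hc, hbc⟩
    obtain ⟨w, hw, h⟩ := hU1 (b, c) ⟨hb, hc, hbc⟩
    exact ⟨w, Finset.mem_insert_of_mem (Finset.mem_union_left _ hw), h⟩
  obtain ⟨w, hw⟩ := exists_word (R := 2 * r + 8) (N := N) (T := T) (a := a)
    (Finset.mem_insert_self _ _)
    (fun X hX haX hXT => exists_near_of_ne hconn hcoconn hcov hT hX ⟨a, haX⟩ hXT)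
    (![(U : Set (Fin d → ℤ)), R, K₁, K₂]) (by
      intro i y hy
      refine Finset.mem_coe.2 (Finset.mem_insert_of_mem ?_)
      simp only [Finset.mem_union]
      fin_cases i
      · exact Or.inl hy
      · exact Or.inr (Or.inl (Or.inl hy))
      · exact Or.inr (Or.inl (Or.inr hy))
      · exact Or.inr (Or.inr hy)) (by
      have : (2 : ℝ) * T.card ≤ N := by linarith
      exact_mod_cast this)
  refine ⟨k, hn ▸ hkn, w, hc, hreg, hfin, hn, ?_⟩
  rw [hw]
  exact hap

/-- The counting bound, before simplification. -/
lemma oddCutsets_finite_and_ncard_le {n r N : ℕ} (hd : 2 ≤ d)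
    (hN : 700 * (n * scale d / d ^ 2) ≤ N) :
    (oddCutsets d n r).Finite ∧ (oddCutsets d n r).ncard ≤
      n * ((2 * d + 1) ^ (2 * r + 8) * 2 ^ 4) ^ N *
        2 ^ (n / (2 * d + 1 - ⌈Real.sqrt d⌉₊)) := by
  classical
  let o : Set (Fin d → ℤ) := {x | IsOddVertex x}
  have ho : IsClass o := isClass_odd
  have htd : ⌈Real.sqrt d⌉₊ ≤ 2 * d := by
    refine Nat.ceil_le.2 ?_
    push_cast
    refine Real.sqrt_le_iff.2 ⟨by positivity, ?_⟩
    have : (2 : ℝ) ≤ d := by exact_mod_cast hd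
    nlinarith
  let Φ : Fin n × Word d r N → Set (Set (Fin d → ℤ)) := fun q =>
    approximatedSets o n (pairOf o ⌈Real.sqrt d⌉₊
      (decode ((q.1 : ℤ) • step (⟨0, by omega⟩, true)) (List.ofFn q.2)))
  have hΦ : ∀ q, (Φ q).Finite ∧ (Φ q).ncard ≤ 2 ^ (n / (2 * d + 1 - ⌈Real.sqrt d⌉₊)) := fun q =>
    approximatedSets_finite_and_ncard_le ho htd (isTight_refinePair ho _ _ _)
  have hsub : oddCutsets d n r ⊆ ⋃ q ∈ (Finset.univ : Finset (Fin n × Word d r N)), Φ q := by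
    intro S hS
    obtain ⟨k, hk, w, hw⟩ := exists_word_approximating hd hS hN
    simp only [Finset.mem_univ, Set.iUnion_true, Set.mem_iUnion]
    exact ⟨(⟨k, hk⟩, w), hw⟩
  have hfin : (⋃ q ∈ (Finset.univ : Finset (Fin n × Word d r N)), Φ q).Finite :=
    Set.Finite.biUnion (Finset.finite_toSet _) fun q _ => (hΦ q).1
  refine ⟨hfin.subset hsub, (Set.ncard_le_ncard hsub hfin).trans ?_⟩
  refine (Finset.set_ncard_biUnion_le _ _).trans ?_
  refine (Finset.sum_le_card_nsmul _ _ _ fun q _ => (hΦ q).2).trans_eq ?_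
  rw [Finset.card_univ, Fintype.card_prod, card_word, Fintype.card_fin, smul_eq_mul]

lemma sq_le_of_mem_oddCutsets {n r : ℕ} (hd : 2 ≤ d) {S : Set (Fin d → ℤ)}
    (hS : S ∈ oddCutsets d n r) : d ^ 2 ≤ n := by
  obtain ⟨⟨hfin, hreg, hconn, -⟩, hodd, hn, -⟩ := hS
  rw [ncard_edgeBoundary] at hn
  obtain ⟨x, hx⟩ := hconn.nonempty
  exact hn ▸ sq_le_ncard_edgePairs isClass_odd hodd.closedOff hreg hfin ⟨x, hx⟩ hd

/-! ### Numerical estimates. -/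

lemma natCast_le_exp {n : ℕ} (hd : 2 ≤ d) (hn : d ^ 2 ≤ n) :
    (n : ℝ) ≤ Real.exp (6 * (n * scale d / d ^ 2)) := by
  have hd1 : (2 : ℝ) ≤ d := by exact_mod_cast hd
  have hn' : (d : ℝ) ^ 2 ≤ n := by exact_mod_cast hn
  have hq := one_le_scale hd
  have hlog : Real.log 2 ≤ Real.log d := Real.log_le_log (by norm_num) hd1
  have hlog2 := Real.log_two_gt_d9
  set z := n * scale d / d ^ 2 with hz
  have hz1 : 1 ≤ z := by
    rw [hz, le_div_iff₀ (by positivity)]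
    nlinarith
  have hsq : (d : ℝ) ^ 2 ≤ 3 * scale d ^ 4 := by
    have : scale d ^ 4 = (d * Real.log d) ^ 2 := by rw [← scale_sq hd]; ring
    rw [this, mul_pow]
    have : (1 : ℝ) ≤ 3 * Real.log d ^ 2 := by nlinarith
    nlinarith [sq_nonneg (d : ℝ)]
  -- This combines `d ^ 6 ≤ n ^ 3` with `d ^ 2 ≤ 3 * scale d ^ 4`.
  have h1 : (n : ℝ) ≤ 3 * z ^ 4 := by
    have h2 : 3 * z ^ 4 = n ^ 4 * (3 * scale d ^ 4) / d ^ 8 := by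
      rw [hz]; field_simp
    rw [h2, le_div_iff₀ (by positivity)]
    calc (n : ℝ) * d ^ 8 = n * (d ^ 2) ^ 3 * d ^ 2 := by ring
      _ ≤ n * n ^ 3 * (3 * scale d ^ 4) := by gcongr
      _ = _ := by ring
  have h3 : z ≤ Real.exp z := by linarith [Real.add_one_le_exp z]
  have h4 : (3 : ℝ) ≤ Real.exp (2 * z) := by linarith [Real.add_one_le_exp (2 * z)]
  calc (n : ℝ) ≤ 3 * z ^ 4 := h1
    _ ≤ Real.exp (2 * z) * Real.exp z ^ 4 := by gcongr
    _ = Real.exp (6 * z) := by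
      rw [← Real.exp_nat_mul, ← Real.exp_add]
      congr 1
      push_cast
      ring

lemma word_base_le {r : ℕ} (hd : 2 ≤ d) (hr : 1 ≤ r) :
    (((2 * d + 1) ^ (2 * r + 8) * 2 ^ 4 : ℕ) : ℝ) ≤ Real.exp (34 * r * Real.log d) := by
  have h1 : 2 * d + 1 ≤ d ^ 3 := by nlinarith [Nat.mul_le_mul hd hd, sq_nonneg d]
  have h2 : (2 * d + 1) ^ (2 * r + 8) * 2 ^ 4 ≤ d ^ (34 * r) := by
    calc (2 * d + 1) ^ (2 * r + 8) * 2 ^ 4 ≤ (d ^ 3) ^ (2 * r + 8) * d ^ 4 := by gcongr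
      _ = d ^ (6 * r + 28) := by rw [← pow_mul, ← pow_add]; congr 1; ring
      _ ≤ d ^ (34 * r) := Nat.pow_le_pow_right (by omega) (by omega)
  have hdpos : (0 : ℝ) < d := by exact_mod_cast (by omega : 0 < d)
  calc (((2 * d + 1) ^ (2 * r + 8) * 2 ^ 4 : ℕ) : ℝ) ≤ ((d ^ (34 * r) : ℕ) : ℝ) := by
        exact_mod_cast h2
    _ = Real.exp (34 * r * Real.log d) := by
      have : 34 * r * Real.log d = ((34 * r : ℕ) : ℝ) * Real.log d := by push_cast; ring
      rw [this, Real.exp_nat_mul, Real.exp_log hdpos, Nat.cast_pow]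

lemma natCast_div_le {n : ℕ} (hd : 2 ≤ d) :
    ((n / (2 * d + 1 - ⌈Real.sqrt d⌉₊) : ℕ) : ℝ) ≤ n / (2 * d) * (1 + 1 / Real.sqrt d) := by
  have hd1 : (2 : ℝ) ≤ d := by exact_mod_cast hd
  set u := Real.sqrt d with hu
  have hu1 : 1 ≤ u := Real.one_le_sqrt.2 (by linarith)
  have huu : u * u = d := Real.mul_self_sqrt (by linarith)
  have hceil := Nat.ceil_lt_add_one (by linarith : (0 : ℝ) ≤ u)
  have hle : ⌈u⌉₊ ≤ 2 * d + 1 := by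
    have : (⌈u⌉₊ : ℝ) ≤ ((2 * d + 1 : ℕ) : ℝ) := by push_cast; nlinarith
    exact_mod_cast this
  have h1 : 2 * (d : ℝ) - u ≤ ((2 * d + 1 - ⌈u⌉₊ : ℕ) : ℝ) := by
    rw [Nat.cast_sub hle]; push_cast; linarith
  have h2 : 0 < 2 * (d : ℝ) - u := by nlinarith
  calc ((n / (2 * d + 1 - ⌈u⌉₊) : ℕ) : ℝ) ≤ n / ((2 * d + 1 - ⌈u⌉₊ : ℕ) : ℝ) := Nat.cast_div_le
    _ ≤ n / (2 * d - u) := by gcongr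
    _ ≤ n / (2 * d) * (1 + 1 / u) := by
      rw [div_le_iff₀ h2]
      have h3 : (2 * (d : ℝ)) ≤ (1 + 1 / u) * (2 * d - u) := by
        have : (1 + 1 / u) * (2 * d - u) = 2 * d + (u - 1) := by
          rw [← huu]; field_simp; ring
        linarith
      calc (n : ℝ) = n / (2 * d) * (2 * d) := by field_simp
        _ ≤ n / (2 * d) * ((1 + 1 / u) * (2 * d - u)) := by gcongr
        _ = _ := by ring

/-- The left side is the order of the cost of a word per unit of `r`; this is where `log^{3/2} d /
√d` comes from. -/
lemma scale_mul_log (hd : 2 ≤ d) (n : ℝ) :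
    n * scale d / d ^ 2 * Real.log d =
      2 * (n / (2 * d) * (Real.log d ^ (3 / 2 : ℝ) / Real.sqrt d)) := by
  have hd1 : (2 : ℝ) ≤ d := by exact_mod_cast hd
  have hlog : 0 < Real.log d := Real.log_pos (by linarith)
  have h1 : Real.log d ^ (3 / 2 : ℝ) = Real.log d * Real.sqrt (Real.log d) := by
    rw [show (3 / 2 : ℝ) = 1 + 1 / 2 by norm_num, Real.rpow_add hlog, Real.rpow_one,
      Real.sqrt_eq_rpow]
  have h2 : scale d = Real.sqrt d * Real.sqrt (Real.log d) := Real.sqrt_mul (by linarith) _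
  have hu : 0 < Real.sqrt d := Real.sqrt_pos.2 (by linarith)
  have huu : Real.sqrt d ^ 2 = d := Real.sq_sqrt (by linarith)
  rw [h1, h2]
  field_simp
  rw [huu]

lemma one_le_two_mul_log_rpow (hd : 2 ≤ d) : 1 ≤ 2 * Real.log d ^ (3 / 2 : ℝ) := by
  have hd1 : (2 : ℝ) ≤ d := by exact_mod_cast hd
  have hlog : Real.log 2 ≤ Real.log d := Real.log_le_log (by norm_num) hd1
  have hlog2 := Real.log_two_gt_d9
  rw [show (3 / 2 : ℝ) = 1 + 1 / 2 by norm_num, Real.rpow_add (by linarith), Real.rpow_one,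
    ← Real.sqrt_eq_rpow]
  have h1 : (8 / 10 : ℝ) ≤ Real.sqrt (Real.log d) := Real.le_sqrt_of_sq_le (by norm_num; linarith)
  nlinarith

end OddCutset

theorem theorem3p1 :
    ∃ C : ℝ, 0 < C ∧ ∀ d n r : ℕ, 2 ≤ d → 1 ≤ n → 1 ≤ r →
      (OddCutset.oddCutsets d n r).Finite ∧
        ((OddCutset.oddCutsets d n r).ncard : ℝ) ≤
          (2 : ℝ) ^ (((n : ℝ) / (2 * (d : ℝ))) *
            (1 + C * (r : ℝ) * (Real.log (d : ℝ)) ^ (3 / 2 : ℝ) / Real.sqrt (d : ℝ))) := by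
  -- In units of `r * (E * Y)` the exponent collects `18` from the starting point and `47668 = 701 *
  -- 34 * 2` from the word; the constant absorbs these after multiplication by `log 2 ≥ 0.69`,
  -- together with `2 * log 2` from the deviation count.
  refine ⟨100000, by norm_num, fun d n r hd _ hr => ?_⟩
  set z := (n : ℝ) * OddCutset.scale d / d ^ 2 with hz
  obtain ⟨hfin, hcard⟩ := OddCutset.oddCutsets_finite_and_ncard_le (n := n) (r := r) hd
    (Nat.le_ceil (700 * z))
  refine ⟨hfin, ?_⟩
  -- The empty case is split off because `d ^ 2 ≤ n`, and hence `1 ≤ z`, is obtained from an actual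
  -- cutset.
  rcases (OddCutset.oddCutsets d n r).eq_empty_or_nonempty with hempty | ⟨S, hS⟩
  · rw [hempty, Set.ncard_empty, Nat.cast_zero]
    positivity
  have hn := OddCutset.sq_le_of_mem_oddCutsets hd hS
  have hn' : (d : ℝ) ^ 2 ≤ n := by exact_mod_cast hn
  have hd1 : (2 : ℝ) ≤ d := by exact_mod_cast hd
  have hr1 : (1 : ℝ) ≤ r := by exact_mod_cast hr
  have hq := OddCutset.one_le_scale hd
  have hlog : Real.log 2 ≤ Real.log d := Real.log_le_log (by norm_num) hd1
  have hlog2 := Real.log_two_gt_d9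
  have hz1 : 1 ≤ z := by
    rw [hz, le_div_iff₀ (by positivity)]
    nlinarith
  have hN : (⌈700 * z⌉₊ : ℝ) ≤ 701 * z := by
    have := Nat.ceil_lt_add_one (by linarith : 0 ≤ 700 * z)
    linarith
  have h1 := OddCutset.natCast_le_exp hd hn
  have h2 := OddCutset.word_base_le hd hr
  have h3 := OddCutset.natCast_div_le (n := n) hd
  have h4 := OddCutset.scale_mul_log hd n
  have h5 := OddCutset.one_le_two_mul_log_rpow hd
  rw [← hz] at h1 h4
  set M := (2 * d + 1) ^ (2 * r + 8) * 2 ^ 4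
  set m := n / (2 * d + 1 - ⌈Real.sqrt d⌉₊)
  set E := (n : ℝ) / (2 * d) with hE
  set L := Real.log d
  set Y := L ^ (3 / 2 : ℝ) / Real.sqrt d with hY
  have hsqrt : 0 < Real.sqrt d := Real.sqrt_pos.2 (by linarith)
  have hE0 : 0 ≤ E := by positivity
  have hY1 : 1 / Real.sqrt d ≤ 2 * Y := by
    rw [hY, mul_div_assoc']
    gcongr
  have hY0 : 0 ≤ Y := by
    have : 0 < 1 / Real.sqrt d := by positivity
    linarith
  have hEY : 0 ≤ E * Y := mul_nonneg hE0 hY0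
  have hrEY : E * Y ≤ r * (E * Y) := le_mul_of_one_le_left hEY hr1
  have hexp : (100000 : ℝ) * r * L ^ (3 / 2 : ℝ) / Real.sqrt d = 100000 * (r * Y) := by
    rw [hY]; ring
  have hM : (M : ℝ) ^ ⌈700 * z⌉₊ ≤ Real.exp (47668 * (r * (E * Y))) := by
    calc (M : ℝ) ^ ⌈700 * z⌉₊ ≤ Real.exp (34 * r * L) ^ ⌈700 * z⌉₊ := by gcongr
      _ = Real.exp (⌈700 * z⌉₊ * (34 * r * L)) := (Real.exp_nat_mul _ _).symm
      _ ≤ Real.exp (701 * z * (34 * r * L)) := by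
        gcongr
      _ = Real.exp (47668 * (r * (E * Y))) := by
        congr 1
        linear_combination (701 * 34 * r : ℝ) * h4
  have hm : (2 : ℝ) ^ m ≤ Real.exp (Real.log 2 * (E * (1 + 2 * Y))) := by
    rw [← Real.rpow_natCast, Real.rpow_def_of_pos (by norm_num)]
    gcongr
    exact h3.trans (by gcongr)
  have hn6 : (n : ℝ) ≤ Real.exp (18 * (r * (E * Y))) := by
    refine h1.trans (Real.exp_le_exp.2 ?_)
    nlinarith
  rw [hexp, Real.rpow_def_of_pos (by norm_num)]
  calc ((OddCutset.oddCutsets d n r).ncard : ℝ) ≤ n * (M : ℝ) ^ ⌈700 * z⌉₊ * (2 : ℝ) ^ m := by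
        exact_mod_cast hcard
    _ ≤ Real.exp (18 * (r * (E * Y))) * Real.exp (47668 * (r * (E * Y))) *
        Real.exp (Real.log 2 * (E * (1 + 2 * Y))) := by gcongr
    _ = Real.exp (18 * (r * (E * Y)) + 47668 * (r * (E * Y)) +
        Real.log 2 * (E * (1 + 2 * Y))) := by rw [Real.exp_add, Real.exp_add]
    _ ≤ _ := by
      refine Real.exp_le_exp.2 ?_
      have a1 : Real.log 2 * (E * (1 + 2 * Y)) ≤
          Real.log 2 * E + 2 * (Real.log 2 * (r * (E * Y))) := by nlinarith
      have a2 : Real.log 2 * (E * (1 + 100000 * (r * Y))) =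
          Real.log 2 * E + 100000 * (Real.log 2 * (r * (E * Y))) := by ring
      have a3 : 0.69 * (r * (E * Y)) ≤ Real.log 2 * (r * (E * Y)) :=
        mul_le_mul_of_nonneg_right (by linarith) (hEY.trans hrEY)
      rw [a2]
      linarith
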